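/- Let $n,m,q\ge 0$ be integers, let $Y=\mathbb R^{n+m}\to X=\mathbb R^n$ be the trivial bundle with coordinates $(x^\lambda,y^i)$, and let $F=\mathbb R^n\times\mathbb R^q\to\mathbb R^n$ be the vector bundle whose dual fibre coordinates $c^a$ are regarded as odd variables (every vector bundle over $\mathbb R^n$ is isomorphic to such an $F$). Write $s^A$ for the collection $(y^i,c^a)$, and $s^A_\Lambda$ for the corresponding jet variables, where $\Lambda$ runs over the symmetric multi-indices in $\{1,\dots,n\}$, $|\Lambda|$ is the length of $\Lambda$, and $\lambda+\Lambda$ is $\Lambda$ with $\lambda$ adjoined. Let $\mathcal S^0_\infty=\mathcal S^0_\infty[F;Y]$ be the graded-commutative ring of polynomials in the odd variables $c^a_\Lambda$ whose coefficients are smooth functions of $(x^\lambda,y^i_\Lambda)$ on finite order jet manifolds $J^rY$ (modulo pull-back). Let $\partial_\lambda=\partial/\partial x^\lambda$ and $\partial^\Lambda_A=\partial/\partial s^A_\Lambda$ be its (left) graded derivations, let $d_\lambda=\partial_\lambda+\sum_{A,\Lambda}s^A_{\lambda+\Lambda}\,\partial^\Lambda_A$ be the total derivatives, and let $d_\Lambda=d_{\lambda_1}\cdots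 d_{\lambda_k}$ for $\Lambda=(\lambda_1\dots\lambda_k)$. Let $\theta^A_\Lambda=ds^A_\Lambda-s^A_{\lambda+\Lambda}dx^\lambda$. For $0\le r\le n$, let $\mathcal S^{0,r}_\infty$ be the space of horizontal graded forms $\frac1{r!}\sum f_{\lambda_1\dots\lambda_r}dx^{\lambda_1}\wedge\dots\wedge dx^{\lambda_r}$ with $f_{\lambda_1\dots\lambda_r}\in\mathcal S^0_\infty$ (so $\mathcal S^{0,0}_\infty=\mathcal S^0_\infty$), and let $\mathcal S^{1,r}_\infty$ be the space of one-contact graded forms $\phi=\sum_{A,\Lambda}\theta^A_\Lambda\wedge\phi^\Lambda_A$ (finite sums) with $\phi^\Lambda_A\in\mathcal S^{0,r}_\infty$. On these spaces let $d_H\phi=dx^\lambda\wedge d_\lambda\phi$, where $d_\lambda$ acts on forms as the Lie derivative, so that $d_\lambda(dx^\mu)=0$ and $d_\lambda(\theta^A_\Lambda)=\theta^A_{\lambda+\Lambda}$. On $\mathcal S^{1,n}_\infty$ let $$\varrho\Big(\sum_{A,\Lambda}\theta^A_\Lambda\wedge\phi^\Lambda_A\Big)=\sum_{A,\Lambda}(-1)^{|\Lambda|}\,\theta^A\wedge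 d_\Lambda\phi^\Lambda_A ,$$ let $\mathbf E_1=\varrho(\mathcal S^{1,n}_\infty)$, and on $\mathcal S^{0,n}_\infty$ let $\delta=\varrho\circ d$, i.e. $\delta L=\varrho\big(\sum_{A,\Lambda}\theta^A_\Lambda\wedge\partial^\Lambda_A L\big)$. Then: (i) the short variational complex $$0\to\mathbb R\to\mathcal S^{0,0}_\infty\xrightarrow{d_H}\mathcal S^{0,1}_\infty\xrightarrow{d_H}\cdots\xrightarrow{d_H}\mathcal S^{0,n}_\infty\xrightarrow{\ \delta\ }\mathbf E_1$$ is exact at each of the terms $\mathcal S^{0,r}_\infty$, $0\le r\le n$; (ii) the complex of one-contact graded forms $$0\to\mathcal S^{1,0}_\infty\xrightarrow{d_H}\mathcal S^{1,1}_\infty\xrightarrow{d_H}\cdots\xrightarrow{d_H}\mathcal S^{1,n}_\infty\xrightarrow{\ \varrho\ }\mathbf E_1\to0$$ is exact at every term. -/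

import Mathlib

open scoped ContDiff TensorProduct

noncomputable section

namespace GradedJet

/-- Symmetric multi-indices `Λ = (λ₁ … λₖ)`, `1 ≤ λⱼ ≤ n`, recorded by multiplicities:
`|Λ|` is `Λ.degree`, and `λ + Λ` is `Λ + Finsupp.single λ 1`. -/
abbrev MultiIndex (n : ℕ) : Type := Fin n →₀ ℕ

/-- `λ + Λ`. -/
def MultiIndex.cons {n : ℕ} (l : Fin n) (L : MultiIndex n) : MultiIndex n :=
  L + Finsupp.single l 1

/-- Labels of the coordinates `x^λ` (left) and `y^i_Λ` (right) of the infinite order jet manifold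
of `ℝ^{n+m} → ℝ^n`. -/
abbrev EvenCoord (n m : ℕ) : Type := Fin n ⊕ (Fin m × MultiIndex n)

/-- The jet order of a coordinate: `0` for `x^λ`, and `|Λ|` for `y^i_Λ`. -/
def EvenCoord.order {n m : ℕ} : EvenCoord n m → ℕ
  | Sum.inl _ => 0
  | Sum.inr (_, L) => L.degree

/-- Labels of the coordinates of `J^rY`. -/
abbrev JetCoord (n m r : ℕ) : Type := {z : EvenCoord n m // z.order ≤ r}

instance JetCoord.finite (n m r : ℕ) : Finite (JetCoord n m r) := by
  have h : ({z : EvenCoord n m | z.order ≤ r}).Finite := by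
    refine Set.Finite.subset (((Set.finite_univ (α := Fin n)).image Sum.inl).union
      (((Set.finite_univ (α := Fin m)).prod (Finsupp.finite_of_degree_le (σ := Fin n) r)).image
        Sum.inr)) ?_
    rintro (l | ⟨i, L⟩) hz
    · left; exact ⟨l, trivial, rfl⟩
    · right; exact ⟨(i, L), ⟨trivial, hz⟩, rfl⟩
  exact h.to_subtype

instance JetCoord.fintype (n m r : ℕ) : Fintype (JetCoord n m r) := Fintype.ofFinite _

/-- The jet manifold `J^rY` of `Y = ℝ^{n+m} → ℝ^n`, in its global coordinates. -/
abbrev Jet (n m r : ℕ) : Type := JetCoord n m r → ℝ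

/-- The infinite order jet manifold `J^∞Y`, the projective limit of the `J^rY`. -/
abbrev JetInf (n m : ℕ) : Type := EvenCoord n m → ℝ

/-- The projection `π^∞_r : J^∞Y → J^rY`. -/
def proj {n m : ℕ} (r : ℕ) (p : JetInf n m) : Jet n m r := fun z => p z.1

/-- Smooth functions on `J^rY` pulled back to `J^∞Y`. -/
def IsSmoothOfOrder {n m : ℕ} (r : ℕ) (f : JetInf n m → ℝ) : Prop :=
  ∃ g : Jet n m r → ℝ, ContDiff ℝ ∞ g ∧ ∀ p, f p = g (proj r p)

theorem IsSmoothOfOrder.mono {n m r s : ℕ} (hrs : r ≤ s) {f : JetInf n m → ℝ}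
    (hf : IsSmoothOfOrder r f) : IsSmoothOfOrder s f := by
  obtain ⟨g, hg, hfg⟩ := hf
  refine ⟨fun q => g (fun z => q ⟨z.1, z.2.trans hrs⟩), hg.comp ?_, fun p => hfg p⟩
  exact contDiff_pi.2 fun z => contDiff_apply ℝ ℝ _

/-- Smooth functions on finite order jet manifolds, as functions on `J^∞Y`. -/
def smoothSubalgebra (n m : ℕ) : Subalgebra ℝ (JetInf n m → ℝ) where
  carrier := {f | ∃ r, IsSmoothOfOrder r f}
  mul_mem' := by
    rintro f f' ⟨r, hf⟩ ⟨s, hf'⟩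
    obtain ⟨g, hg, hfg⟩ := hf.mono (le_max_left r s)
    obtain ⟨g', hg', hfg'⟩ := hf'.mono (le_max_right r s)
    exact ⟨max r s, fun q => g q * g' q, hg.mul hg', fun p => by simp [hfg p, hfg' p]⟩
  add_mem' := by
    rintro f f' ⟨r, hf⟩ ⟨s, hf'⟩
    obtain ⟨g, hg, hfg⟩ := hf.mono (le_max_left r s)
    obtain ⟨g', hg', hfg'⟩ := hf'.mono (le_max_right r s)
    exact ⟨max r s, fun q => g q + g' q, hg.add hg', fun p => by simp [hfg p, hfg' p]⟩
  algebraMap_mem' c := ⟨0, fun _ => c, contDiff_const, fun _ => rfl⟩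

/-- The ring `O^0_∞Y` of smooth functions on finite order jet manifolds modulo the pull-back
identification, i.e. the direct limit of the rings `C^∞(J^rY)`. -/
def SmoothFun (n m : ℕ) : Type := smoothSubalgebra n m

instance SmoothFun.commRing (n m : ℕ) : CommRing (SmoothFun n m) :=
  inferInstanceAs (CommRing (smoothSubalgebra n m))

instance SmoothFun.algebra (n m : ℕ) : Algebra ℝ (SmoothFun n m) :=
  inferInstanceAs (Algebra ℝ (smoothSubalgebra n m))

/-- The coordinate functions `x^λ` and `y^i_Λ`. -/
def evenCoord {n m : ℕ} (z : EvenCoord n m) : SmoothFun n m :=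
  ⟨fun p => p z, z.order, fun q => q ⟨z, le_rfl⟩, contDiff_apply ℝ ℝ _, fun _ => rfl⟩

theorem hasLineDerivAt_of_smooth {n m r : ℕ} {f : JetInf n m → ℝ} {g : Jet n m r → ℝ}
    (hg : ContDiff ℝ ∞ g) (hfg : ∀ p, f p = g (proj r p)) (p v : JetInf n m) :
    HasLineDerivAt ℝ f (fderiv ℝ g (proj r p) (proj r v)) p v := by
  have h := ((hg.differentiable (by simp)) (proj r p)).hasFDerivAt.hasLineDerivAt (proj r v)
  unfold HasLineDerivAt at h ⊢
  convert h using 2 with t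
  exact hfg _

/-- The partial derivative `∂/∂z` of smooth functions on `J^∞Y`, `z = x^λ` or `z = y^i_Λ`. -/
def evenPartial {n m : ℕ} (z : EvenCoord n m) : SmoothFun n m →ₗ[ℝ] SmoothFun n m where
  toFun f := ⟨fun p => lineDeriv ℝ f.1 p (Pi.single z 1), by
    obtain ⟨f, r, g, hg, hfg⟩ := f
    refine ⟨r, fun q => fderiv ℝ g q (proj r (Pi.single z 1)), ?_, fun p =>
      (hasLineDerivAt_of_smooth hg hfg p _).lineDeriv⟩
    exact (hg.fderiv_right (m := ∞) (by simp)).clm_apply contDiff_const⟩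
  map_add' := by
    rintro ⟨f, r, g, hg, hfg⟩ ⟨f', r', g', hg', hfg'⟩
    refine Subtype.ext (funext fun p => ?_)
    have h := hasLineDerivAt_of_smooth hg hfg p (Pi.single z 1)
    have h' := hasLineDerivAt_of_smooth hg' hfg' p (Pi.single z 1)
    have h2 : HasLineDerivAt ℝ (f + f') _ p (Pi.single z 1) := HasDerivAt.add h h'
    change lineDeriv ℝ (f + f') p _ = lineDeriv ℝ f p _ + lineDeriv ℝ f' p _
    rw [h.lineDeriv, h'.lineDeriv, h2.lineDeriv]
  map_smul' := by
    rintro c ⟨f, r, g, hg, hfg⟩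
    refine Subtype.ext (funext fun p => ?_)
    have h := hasLineDerivAt_of_smooth hg hfg p (Pi.single z 1)
    have h2 : HasLineDerivAt ℝ (c • f) _ p (Pi.single z 1) := HasDerivAt.const_smul c h
    change lineDeriv ℝ (c • f) p _ = c • lineDeriv ℝ f p _
    rw [h.lineDeriv, h2.lineDeriv]

theorem evenPartial_finite {n m : ℕ} (f : SmoothFun n m) :
    {z : EvenCoord n m | evenPartial z f ≠ 0}.Finite := by
  obtain ⟨f, r, g, hg, hfg⟩ := f
  have hfin : ({z : EvenCoord n m | z.order ≤ r}).Finite :=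
    Set.finite_coe_iff.1 (JetCoord.finite n m r)
  refine hfin.subset fun z hz => ?_
  by_contra hlt
  apply hz
  refine Subtype.ext (funext fun p => ?_)
  change lineDeriv ℝ f p (Pi.single z 1) = 0
  rw [(hasLineDerivAt_of_smooth hg hfg p _).lineDeriv]
  have : proj r (Pi.single z (1 : ℝ)) = 0 := by
    ext w
    have hw : w.1 ≠ z := fun h => hlt (h ▸ w.2)
    simp [proj, hw]
  rw [this, map_zero]

/-- Labels of the odd variables `c^a_Λ`. -/
abbrev OddCoord (n q : ℕ) : Type := Fin q × MultiIndex n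

/-- The real Grassmann algebra generated by the `c^a_Λ`. -/
abbrev Grassmann (n q : ℕ) : Type := ExteriorAlgebra ℝ (OddCoord n q →₀ ℝ)

/-- The left derivative `∂/∂c^a_Λ` of the Grassmann algebra:
`∂(c^b_Σ ξ) = δ ξ - c^b_Σ ∂ξ`. -/
def oddPartial {n q : ℕ} (z : OddCoord n q) : Grassmann n q →ₗ[ℝ] Grassmann n q :=
  CliffordAlgebra.contractLeft (Q := (0 : QuadraticForm ℝ (OddCoord n q →₀ ℝ)))
    (Finsupp.lapply z)

theorem oddPartial_finite {n q : ℕ} (x : Grassmann n q) :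
    {z : OddCoord n q | oddPartial z x ≠ 0}.Finite := by
  induction x using CliffordAlgebra.left_induction with
  | algebraMap c => simp [oddPartial, CliffordAlgebra.contractLeft_algebraMap]
  | add x y hx hy =>
    refine (hx.union hy).subset fun z hz => ?_
    by_contra h
    simp only [Set.mem_union, Set.mem_ofPred_eq, not_or, not_not] at h
    exact hz (by rw [map_add, h.1, h.2, add_zero])
  | ι_mul x v hx =>
    refine (hx.union v.support.finite_toSet).subset fun z hz => ?_
    by_contra h
    simp only [Set.mem_union, Set.mem_ofPred_eq, not_or, not_not, Finset.mem_coe,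
      Finsupp.mem_support_iff] at h
    refine hz ?_
    have h1 := h.1
    unfold oddPartial at h1 ⊢
    rw [CliffordAlgebra.contractLeft_ι_mul, h1, Finsupp.lapply_apply, h.2]
    simp

/-- The ring `S^0_∞[F;Y]` of graded functions, for `Y = ℝ^{n+m} → ℝ^n` and
`F = ℝ^n × ℝ^q → ℝ^n`: polynomials in the odd variables `c^a_Λ` whose coefficients are smooth
functions on finite order jet manifolds of `Y`. -/
abbrev GradedFun (n m q : ℕ) : Type := SmoothFun n m ⊗[ℝ] Grassmann n q

/-- Labels `(A, Λ)` of the variables `s^A_Λ`: `y^i_Λ` if `A = i` is on the left, `c^a_Λ` if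
`A = a` is on the right. -/
abbrev FibreCoord (n m q : ℕ) : Type := (Fin m ⊕ Fin q) × MultiIndex n

/-- The variables `s^A_Λ` as graded functions. -/
def fibreCoord {n m q : ℕ} : FibreCoord n m q → GradedFun n m q
  | (Sum.inl i, L) => evenCoord (Sum.inr (i, L)) ⊗ₜ[ℝ] 1
  | (Sum.inr a, L) => 1 ⊗ₜ[ℝ] ExteriorAlgebra.ι ℝ (Finsupp.single (a, L) 1)

/-- The derivation `∂_λ = ∂/∂x^λ` of graded functions. -/
def basePartial {n m q : ℕ} (l : Fin n) : GradedFun n m q →ₗ[ℝ] GradedFun n m q :=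
  (evenPartial (Sum.inl l)).rTensor (Grassmann n q)

/-- The graded derivation `∂^Λ_A = ∂/∂s^A_Λ` of graded functions. -/
def fibrePartial {n m q : ℕ} : FibreCoord n m q → (GradedFun n m q →ₗ[ℝ] GradedFun n m q)
  | (Sum.inl i, L) => (evenPartial (Sum.inr (i, L))).rTensor (Grassmann n q)
  | (Sum.inr a, L) => (oddPartial (a, L)).lTensor (SmoothFun n m)

theorem fibrePartial_finite {n m q : ℕ} (f : GradedFun n m q) :
    (Function.support fun k : FibreCoord n m q => fibrePartial k f).Finite := by
  induction f using TensorProduct.induction_on with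
  | zero => simp
  | add x y hx hy =>
    refine (hx.union hy).subset fun z hz => ?_
    by_contra h
    simp only [Set.mem_union, Function.mem_support, not_or, not_not] at h
    refine hz ?_
    change fibrePartial z (x + y) = 0
    rw [map_add, h.1, h.2, add_zero]
  | tmul f x =>
    refine Set.Finite.subset
      ((((evenPartial_finite f).preimage Sum.inr_injective.injOn).image
          fun z : Fin m × MultiIndex n => ((Sum.inl z.1 : Fin m ⊕ Fin q), z.2)).union
        ((oddPartial_finite x).image
          fun z : OddCoord n q => ((Sum.inr z.1 : Fin m ⊕ Fin q), z.2))) ?_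
    rintro ⟨i | a, L⟩ hz
    · refine Or.inl ⟨(i, L), fun h0 => hz ?_, rfl⟩
      simp [fibrePartial, h0]
    · refine Or.inr ⟨(a, L), fun h0 => hz ?_, rfl⟩
      simp [fibrePartial, h0]

/-- One-contact graded one-forms, the module `S^{1,0}_∞[F;Y]`. The finitely supported family `u`
stands for the form `∑ θ^A_Λ u_{(A,Λ)}`, where `θ^A_Λ = ds^A_Λ - s^A_{λ+Λ} dx^λ`. -/
def Contact (n m q : ℕ) : Type := FibreCoord n m q →₀ GradedFun n m q

instance Contact.addCommGroup (n m q : ℕ) : AddCommGroup (Contact n m q) :=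
  inferInstanceAs (AddCommGroup (FibreCoord n m q →₀ GradedFun n m q))

instance Contact.module (n m q : ℕ) : Module ℝ (Contact n m q) :=
  inferInstanceAs (Module ℝ (FibreCoord n m q →₀ GradedFun n m q))

/-- The coefficients of a one-contact one-form: the identity map, which exhibits `S^{1,0}` as the
space of finitely supported families of graded functions. -/
def Contact.coeffs (n m q : ℕ) : Contact n m q ≃ₗ[ℝ] (FibreCoord n m q →₀ GradedFun n m q) :=
  LinearEquiv.refl ℝ (FibreCoord n m q →₀ GradedFun n m q)

/-- The form `θ^A_Λ f`. -/
def Contact.theta {n m q : ℕ} (k : FibreCoord n m q) : GradedFun n m q →ₗ[ℝ] Contact n m q :=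
  (Contact.coeffs n m q).symm.toLinearMap ∘ₗ Finsupp.lsingle k

/-- The linear map on one-contact one-forms given by `∑ θ^A_Λ u_{(A,Λ)} ↦ ∑ T_{(A,Λ)} u_{(A,Λ)}`. -/
def Contact.lift {n m q : ℕ} {V : Type} [AddCommGroup V] [Module ℝ V]
    (T : FibreCoord n m q → GradedFun n m q →ₗ[ℝ] V) : Contact n m q →ₗ[ℝ] V :=
  Finsupp.lsum ℝ T ∘ₗ (Contact.coeffs n m q).toLinearMap

/-- The vertical differential of graded functions, `d_V f = ∑ θ^A_Λ ∂^Λ_A f`. -/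
def vertFun {n m q : ℕ} : GradedFun n m q →ₗ[ℝ] Contact n m q where
  toFun f := (Contact.coeffs n m q).symm
    (Finsupp.ofSupportFinite (fun k => fibrePartial k f) (fibrePartial_finite f))
  map_add' f g := by
    rw [← map_add]
    refine congrArg _ (Finsupp.ext fun k => ?_)
    exact map_add (fibrePartial k) f g
  map_smul' c f := by
    rw [RingHom.id_apply, ← map_smul]
    refine congrArg _ (Finsupp.ext fun k => ?_)
    exact map_smul (fibrePartial k) c f

/-- The total derivative `d_λ = ∂_λ + ∑ s^A_{λ+Λ} ∂^Λ_A` of graded functions. -/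
def totalDeriv {n m q : ℕ} (l : Fin n) : GradedFun n m q →ₗ[ℝ] GradedFun n m q :=
  basePartial l +
    Contact.lift (fun k => LinearMap.mulLeft ℝ (fibreCoord (k.1, k.2.cons l))) ∘ₗ vertFun

/-- The Lie derivative along `d_λ` of one-contact one-forms:
`d_λ(θ^A_Λ f) = θ^A_{λ+Λ} f + θ^A_Λ d_λ f`. -/
def totalDerivContact {n m q : ℕ} (l : Fin n) : Contact n m q →ₗ[ℝ] Contact n m q :=
  Contact.lift fun k => Contact.theta (k.1, k.2.cons l) + Contact.theta k ∘ₗ totalDeriv l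

/-- `d_Λ = d_1^{Λ_1} ⋯ d_n^{Λ_n}`. -/
def iterTotalDeriv {n m q : ℕ} (L : MultiIndex n) : Module.End ℝ (GradedFun n m q) :=
  (List.ofFn fun l : Fin n => (totalDeriv l : Module.End ℝ (GradedFun n m q)) ^ L l).prod

/-- Exterior forms of degree `r` in `dx^1, …, dx^n` with coefficients in `V`: the alternating map
`φ` stands for `(1/r!) ∑ φ(e_{λ₁}, …, e_{λᵣ}) dx^{λ₁} ∧ ⋯ ∧ dx^{λᵣ}`. -/
abbrev HForm (n r : ℕ) (V : Type) [AddCommGroup V] [Module ℝ V] : Type :=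
  (Fin n → ℝ) [⋀^Fin r]→ₗ[ℝ] V

/-- The operator `φ ↦ ∑ dx^λ ∧ D_λ φ`, where `D_λ` acts on coefficients. -/
def wedgeD {n : ℕ} {V : Type} [AddCommGroup V] [Module ℝ V] (D : Fin n → V →ₗ[ℝ] V) (r : ℕ) :
    HForm n r V →ₗ[ℝ] HForm n (r + 1) V :=
  ∑ l : Fin n, AlternatingMap.alternatizeUncurryFinLM ∘ₗ
    LinearMap.smulRightₗ (LinearMap.proj l : (Fin n → ℝ) →ₗ[ℝ] ℝ) ∘ₗ
      (D l).compAlternatingMapₗ ℝ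

/-- The horizontal graded `r`-forms `S^{0,r}_∞[F;Y]`. -/
abbrev S0 (n m q r : ℕ) : Type := HForm n r (GradedFun n m q)

/-- The one-contact, `r`-horizontal graded forms `S^{1,r}_∞[F;Y]`. A family `(φ^Λ_A)` of
horizontal `r`-forms stands for the form `∑ θ^A_Λ ∧ φ^Λ_A`, with the contact factor on the left. -/
abbrev S1 (n m q r : ℕ) : Type := HForm n r (Contact n m q)

/-- The inclusion `ℝ → S^0_∞[F;Y] = S^{0,0}_∞[F;Y]` of the constants. -/
def constants (n m q : ℕ) : ℝ →ₗ[ℝ] S0 n m q 0 :=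
  (AlternatingMap.constLinearEquivOfIsEmpty (R' := ℝ) (M'' := Fin n → ℝ)
    (N'' := GradedFun n m q) (ι := Fin 0)).toLinearMap ∘ₗ Algebra.linearMap ℝ (GradedFun n m q)

/-- The total differential `d_H φ = dx^λ ∧ d_λ φ` on `S^{0,r}`. -/
def dH0 (n m q r : ℕ) : S0 n m q r →ₗ[ℝ] S0 n m q (r + 1) := wedgeD totalDeriv r

/-- The total differential `d_H φ = dx^λ ∧ d_λ φ` on `S^{1,r}`. The sign comes from moving
`dx^λ` past the contact factor: `dx^λ ∧ θ^A_Λ = - θ^A_Λ ∧ dx^λ`. -/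
def dH1 (n m q r : ℕ) : S1 n m q r →ₗ[ℝ] S1 n m q (r + 1) :=
  -wedgeD totalDerivContact r

/-- The vertical differential `d_V φ = θ^A_Λ ∧ ∂^Λ_A φ` on `S^{0,r}`, the one-contact part of the
exterior differential `d = d_H + d_V`. -/
def dV0 (n m q r : ℕ) : S0 n m q r →ₗ[ℝ] S1 n m q r := vertFun.compAlternatingMapₗ ℝ

/-- `θ^A_Λ f ↦ (-1)^{|Λ|} θ^A d_Λ f`. -/
def rhoContact (n m q : ℕ) : Contact n m q →ₗ[ℝ] Contact n m q :=
  Contact.lift fun k =>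
    ((-1 : ℝ) ^ k.2.degree) • (Contact.theta (k.1, 0) ∘ₗ iterTotalDeriv k.2)

/-- The projector `ϱ(φ) = ∑ (-1)^{|Λ|} θ^A ∧ d_Λ(∂^Λ_A ⌋ φ)` on `S^{1,n}`; here
`∂^Λ_A ⌋ φ = φ^Λ_A` for `φ = ∑ θ^A_Λ ∧ φ^Λ_A`, and `d_Λ` acts on coefficients since the Lie
derivative of `dx^μ` along `d_λ` is zero. -/
def rho (n m q : ℕ) : S1 n m q n →ₗ[ℝ] S1 n m q n := (rhoContact n m q).compAlternatingMapₗ ℝ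

/-- `E₁ = ϱ(S^{1,n}_∞[F;Y])`. -/
abbrev E1 (n m q : ℕ) : Submodule ℝ (S1 n m q n) := LinearMap.range (rho n m q)

/-- `ϱ : S^{1,n} → E₁`. -/
def rhoE1 (n m q : ℕ) : S1 n m q n →ₗ[ℝ] E1 n m q := (rho n m q).rangeRestrict

/-- The variational operator `δ = ϱ ∘ d : S^{0,n} → E₁`. On `S^{0,n}` one has `d = d_V`, because
there are no horizontal `(n+1)`-forms. -/
def delta (n m q : ℕ) : S0 n m q n →ₗ[ℝ] E1 n m q := rhoE1 n m q ∘ₗ dV0 n m q n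

/-- The image in `S^{0,r}` of the preceding arrow of the complex
`0 → ℝ → S^{0,0} → S^{0,1} → ⋯ → S^{0,n} → E₁`. -/
def boundary0 (n m q : ℕ) : (r : ℕ) → Submodule ℝ (S0 n m q r)
  | 0 => LinearMap.range (constants n m q)
  | r + 1 => LinearMap.range (dH0 n m q r)

/-- The image in `S^{1,r}` of the preceding arrow of the complex
`0 → S^{1,0} → S^{1,1} → ⋯ → S^{1,n} → E₁ → 0`. -/
def boundary1 (n m q : ℕ) : (r : ℕ) → Submodule ℝ (S1 n m q r)
  | 0 => ⊥
  | r + 1 => LinearMap.range (dH1 n m q r)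

end GradedJet

end

/-! Write `D_λ` for the action of `d_λ` on one-contact one-forms, so that `D_λ(θ_Λ f) = θ_{λ+Λ} f +
θ_Λ d_λ f`. Both complexes have the form `φ ↦ ∑ dx^λ ∧ D_λ φ` for commuting operators on a
coefficient space, and both rest on one Cartan formula, `contract_wedgeD`: if `[P_l, D_k] = c
δ_{lk}`, then contraction with `P` is a homotopy up to `∑ P_l D_l` and a scalar.

One-contact complex. The lowering operators `θ_Λ f ↦ Λ_l θ_{Λ-l} f` satisfy `[P_l, D_k] = δ_{lk}`,
and `∑ P_l D_l` acts on the order `K` part as `K + n`, up to lower order terms. On `(r+1)`-forms the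
homotopy therefore has leading scalar `K + n - (r+1)`, which is nonzero for `r + 1 < n`; descending
on the jet order gives exactness below the top degree. In top degree, `θ_{λ+Λ} u = D_λ(θ_Λ u) - θ_Λ
d_λ u` is integration by parts: it shows that `φ - ϱφ` is exact, while `ϱ ∘ D_λ = 0`.

Short variational complex. If `φ` is closed, then `d_V φ` is a cocycle of the one-contact complex
(at the top, `δφ = 0` says the same), hence a boundary there. A map `T` from contact forms to graded
functions that intertwines `D_λ` with `d_λ` carries boundaries to boundaries. The radial homotopy in
the `y^i_Λ` is such a `T` with `T d_V = 1 - (restriction to y = 0)`, which reduces to `φ`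
independent of the `y^i_Λ`. The substitution `θ^a_Λ ↦ c^a_Λ` is another, with `T d_V = N`, the
number operator of the odd variables; so `Nφ` is a boundary. For large `K` the operator
`(N-1)⋯(N-K)` removes all positive odd degrees, yet modulo boundaries it is the scalar `(-1)^K K!`.
What remains depends on `x` alone, and the Poincaré lemma on `ℝ^n` finishes the proof. -/

noncomputable section

/-! ### Differentiation under the integral sign -/

open MeasureTheory intervalIntegral in
theorem hasFDerivAt_intervalIntegral_of_contDiff {E F : Type} [NormedAddCommGroup E]
    [NormedSpace ℝ E] [ProperSpace E] [NormedAddCommGroup F] [NormedSpace ℝ F]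
    {f : ℝ × E → F} (hf : ContDiff ℝ 1 f) (x : E) :
    HasFDerivAt (fun x => ∫ t in (0 : ℝ)..1, f (t, x))
      (∫ t in (0 : ℝ)..1, (fderiv ℝ f (t, x)).comp (ContinuousLinearMap.inr ℝ ℝ E)) x := by
  have hcont : Continuous fun z : ℝ × E => (fderiv ℝ f z).comp (ContinuousLinearMap.inr ℝ ℝ E) :=
    (hf.continuous_fderiv (by simp)).clm_comp continuous_const
  -- Compactness of `[0,1]` times a closed ball supplies a constant dominating the derivative near
  -- `x`.
  obtain ⟨C, hC⟩ := (isCompact_uIcc (a := (0 : ℝ)) (b := 1)).prod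
    (isCompact_closedBall x 1) |>.exists_bound_of_continuousOn hcont.continuousOn
  refine hasFDerivAt_integral_of_dominated_of_fderiv_le (bound := fun _ => C)
    (F' := fun x t => (fderiv ℝ f (t, x)).comp (ContinuousLinearMap.inr ℝ ℝ E))
    (Metric.ball_mem_nhds x one_pos) ?_ ?_ ?_ ?_ ?_ ?_
  · exact Filter.Eventually.of_forall fun y =>
      (hf.continuous.comp (by fun_prop : Continuous fun t : ℝ => (t, y))).aestronglyMeasurable
  · exact (hf.continuous.comp (by fun_prop : Continuous fun t : ℝ => (t, x))).intervalIntegrable _ _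
  · exact (hcont.comp (by fun_prop : Continuous fun t : ℝ => (t, x))).aestronglyMeasurable
  · refine Filter.Eventually.of_forall fun t ht y hy => hC (t, y) ⟨Set.uIoc_subset_uIcc ht, ?_⟩
    exact Metric.ball_subset_closedBall hy
  · exact intervalIntegrable_const
  · refine Filter.Eventually.of_forall fun t _ y _ => ?_
    have h := ((hf.differentiable (by simp)) (t, y)).hasFDerivAt
    exact h.comp y (hasFDerivAt_prodMk_right t y)

/-- The derivative of a parameter integral is a parameter integral with values in a space of
continuous linear maps, so the induction on the order must quantify over `F`. -/
theorem contDiff_intervalIntegral {E : Type} [NormedAddCommGroup E]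
    [NormedSpace ℝ E] [ProperSpace E] (n : ℕ) : ∀ {F : Type} [NormedAddCommGroup F]
    [NormedSpace ℝ F] {f : ℝ × E → F}, ContDiff ℝ ∞ f →
      ContDiff ℝ n (fun x => ∫ t in (0 : ℝ)..1, f (t, x)) := by
  induction n with
  | zero =>
    intro F _ _ f hf
    refine contDiff_zero.2 (Differentiable.continuous (𝕜 := ℝ) fun x => ?_)
    exact (hasFDerivAt_intervalIntegral_of_contDiff (hf.of_le (by simp)) x).differentiableAt
  | succ n ih =>
    intro F _ _ f hf
    have h := fun x => hasFDerivAt_intervalIntegral_of_contDiff (hf.of_le (by simp)) x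
    refine contDiff_succ_iff_fderiv.2 ⟨fun x => (h x).differentiableAt,
      fun h => absurd h (WithTop.natCast_ne_top n), ?_⟩
    rw [show fderiv ℝ (fun x => ∫ t in (0 : ℝ)..1, f (t, x)) = _ from
      funext fun x => (h x).fderiv]
    refine ih (f := fun z => (fderiv ℝ f z).comp (ContinuousLinearMap.inr ℝ ℝ E)) ?_
    exact (hf.fderiv_right (m := ∞) (by simp)).clm_comp contDiff_const

/-! ### Dilations and averages of smooth functions on jets -/

namespace GradedJet

variable {n m : ℕ}

/-- The dilation of the coordinates in `B`. -/
def dilate (B : Set (EvenCoord n m)) (t : ℝ) (p : JetInf n m) : JetInf n m := by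
  classical exact fun z => if z ∈ B then t * p z else p z

theorem SmoothFun.ext {f g : SmoothFun n m} (h : ∀ p, f.1 p = g.1 p) : f = g :=
  Subtype.ext (funext h)

open Classical in
theorem contDiff_dilate (B : Set (EvenCoord n m)) (r : ℕ) :
    ContDiff ℝ ∞ fun z : ℝ × Jet n m r =>
      (fun w => if w.1 ∈ B then z.1 * z.2 w else z.2 w : Jet n m r) := by
  refine contDiff_pi.2 fun w => ?_
  split_ifs
  · exact contDiff_fst.mul ((contDiff_apply ℝ ℝ w).comp contDiff_snd)
  · exact (contDiff_apply ℝ ℝ w).comp contDiff_snd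

/-- A dilated function depends smoothly on the dilation parameter and on finitely many
coordinates. -/
theorem exists_dilate_eq (B : Set (EvenCoord n m)) (f : SmoothFun n m) :
    ∃ r, ∃ g : ℝ × Jet n m r → ℝ, ContDiff ℝ ∞ g ∧ ∀ t p, f.1 (dilate B t p) = g (t, proj r p) := by
  classical
  obtain ⟨f, r, g, hg, hfg⟩ := f
  refine ⟨r, _, hg.comp (contDiff_dilate B r), fun t p => ?_⟩
  change f _ = _
  rw [hfg]
  rfl

theorem continuous_dilate (B : Set (EvenCoord n m)) (f : SmoothFun n m) (p : JetInf n m) :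
    Continuous fun t => f.1 (dilate B t p) := by
  obtain ⟨r, g, hg, h⟩ := exists_dilate_eq B f
  simp only [h]
  exact hg.continuous.comp (by fun_prop)

/-- The weighted average `∫₀¹ tᵏ f(dilate t p) dt`. -/
def average (B : Set (EvenCoord n m)) (k : ℕ) : SmoothFun n m →ₗ[ℝ] SmoothFun n m where
  toFun f := ⟨fun p => ∫ t in (0 : ℝ)..1, t ^ k * f.1 (dilate B t p), by
    obtain ⟨r, g, hg, h⟩ := exists_dilate_eq B f
    refine ⟨r, fun q => ∫ t in (0 : ℝ)..1, t ^ k * g (t, q), contDiff_infty.2 fun j => ?_,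
      fun p => by simp only [h]⟩
    exact contDiff_intervalIntegral j (f := fun z => z.1 ^ k * g z) ((contDiff_fst.pow k).mul hg)⟩
  map_add' f g := by
    refine SmoothFun.ext fun p => ?_
    change ∫ t in (0 : ℝ)..1, t ^ k * (f.1 (dilate B t p) + g.1 (dilate B t p)) =
      (∫ t in (0 : ℝ)..1, t ^ k * f.1 (dilate B t p)) +
        ∫ t in (0 : ℝ)..1, t ^ k * g.1 (dilate B t p)
    have hf := continuous_dilate B f p
    have hg := continuous_dilate B g p
    rw [← intervalIntegral.integral_add]
    · simp only [mul_add]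
    · exact ((continuous_pow k).mul hf).intervalIntegrable _ _
    · exact ((continuous_pow k).mul hg).intervalIntegrable _ _
  map_smul' c f := by
    refine SmoothFun.ext fun p => ?_
    change ∫ t in (0 : ℝ)..1, t ^ k * (c * f.1 (dilate B t p)) =
      c * ∫ t in (0 : ℝ)..1, t ^ k * f.1 (dilate B t p)
    rw [← intervalIntegral.integral_const_mul]
    simp only [mul_left_comm]

theorem average_apply (B : Set (EvenCoord n m)) (k : ℕ) (f : SmoothFun n m) (p : JetInf n m) :
    (average B k f).1 p = ∫ t in (0 : ℝ)..1, t ^ k * f.1 (dilate B t p) := rfl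

/-- The restriction to the locus where the coordinates in `B` vanish. -/
def restrict (B : Set (EvenCoord n m)) : SmoothFun n m →ₗ[ℝ] SmoothFun n m where
  toFun f := ⟨fun p => f.1 (dilate B 0 p), by
    obtain ⟨r, g, hg, h⟩ := exists_dilate_eq B f
    exact ⟨r, fun q => g (0, q), hg.comp (contDiff_prodMk_right 0), fun p => h 0 p⟩⟩
  map_add' _ _ := rfl
  map_smul' _ _ := rfl

theorem evenPartial_apply (z : EvenCoord n m) (f : SmoothFun n m) (p : JetInf n m) :
    (evenPartial z f).1 p = lineDeriv ℝ f.1 p (Pi.single z 1) := rfl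

theorem SmoothFun.exists_rep (f : SmoothFun n m) :
    ∃ r, ∃ g : Jet n m r → ℝ, ContDiff ℝ ∞ g ∧ ∀ p, f.1 p = g (proj r p) := f.2

theorem hasLineDerivAt_evenPartial (z : EvenCoord n m) (f : SmoothFun n m) (p : JetInf n m) :
    HasLineDerivAt ℝ f.1 ((evenPartial z f).1 p) p (Pi.single z 1) := by
  obtain ⟨r, g, hg, h⟩ := f.exists_rep
  rw [evenPartial_apply]
  exact (hasLineDerivAt_of_smooth hg h p _).lineDifferentiableAt.hasLineDerivAt

theorem evenPartial_apply_eq {z : EvenCoord n m} {f : SmoothFun n m} {p : JetInf n m} {c : ℝ}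
    (h : HasLineDerivAt ℝ f.1 c p (Pi.single z 1)) : (evenPartial z f).1 p = c := h.lineDeriv

theorem evenPartial_eq_fderiv {r : ℕ} {f : SmoothFun n m} {g : Jet n m r → ℝ}
    (hg : ContDiff ℝ ∞ g) (h : ∀ p, f.1 p = g (proj r p)) (z : EvenCoord n m) (p : JetInf n m) :
    (evenPartial z f).1 p = fderiv ℝ g (proj r p) (proj r (Pi.single z 1)) :=
  evenPartial_apply_eq (hasLineDerivAt_of_smooth hg h p _)

theorem evenPartial_mul (z : EvenCoord n m) (f g : SmoothFun n m) :
    evenPartial z (f * g) = evenPartial z f * g + f * evenPartial z g := by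
  refine SmoothFun.ext fun p => evenPartial_apply_eq ?_
  have h := HasDerivAt.mul (hasLineDerivAt_evenPartial z f p) (hasLineDerivAt_evenPartial z g p)
  rw [zero_smul, add_zero] at h
  exact h

open Classical in
theorem evenPartial_evenCoord (z w : EvenCoord n m) :
    evenPartial z (evenCoord w) = if z = w then 1 else 0 := by
  refine SmoothFun.ext fun p => evenPartial_apply_eq ?_
  have h : HasLineDerivAt ℝ (evenCoord w).1 ((Pi.single z (1 : ℝ) : JetInf n m) w) p
      (Pi.single z 1) := by
    change HasDerivAt (fun t : ℝ => p w + t * (Pi.single z (1 : ℝ) : JetInf n m) w) _ 0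
    simpa using ((hasDerivAt_id (0 : ℝ)).mul_const
      ((Pi.single z (1 : ℝ) : JetInf n m) w)).const_add (p w)
  refine h.congr_deriv ?_
  split_ifs with hzw
  · subst hzw
    exact Pi.single_eq_same _ _
  · exact Pi.single_eq_of_ne (Ne.symm hzw) _

theorem evenPartial_comm (z w : EvenCoord n m) (f : SmoothFun n m) :
    evenPartial z (evenPartial w f) = evenPartial w (evenPartial z f) := by
  refine SmoothFun.ext fun p => ?_
  obtain ⟨r, g, hg, h⟩ := f.exists_rep
  have key : ∀ a b : EvenCoord n m, (evenPartial a (evenPartial b f)).1 p =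
      fderiv ℝ (fderiv ℝ g) (proj r p) (proj r (Pi.single a 1)) (proj r (Pi.single b 1)) := by
    intro a b
    have hg' : ContDiff ℝ ∞ (fderiv ℝ g) := hg.fderiv_right (m := ∞) (by simp)
    rw [evenPartial_eq_fderiv (hg'.clm_apply contDiff_const) (evenPartial_eq_fderiv hg h b) a p,
      fderiv_clm_apply (hg'.differentiable (by simp) _) (by fun_prop)]
    simp
  rw [key, key]
  exact (hg.contDiffAt.isSymmSndFDerivAt
    (by rw [minSmoothness_of_isRCLikeNormedField]; exact WithTop.coe_le_coe.2 le_top)).eq _ _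

open Classical in
theorem dilate_single (B : Set (EvenCoord n m)) (z : EvenCoord n m) (t : ℝ) :
    dilate B t (Pi.single z 1) = (if z ∈ B then t else 1) • Pi.single z 1 := by
  ext w
  by_cases hw : w = z
  · subst hw; simp [dilate]
  · simp [dilate, Pi.single_eq_of_ne hw]

theorem dilate_add (B : Set (EvenCoord n m)) (t : ℝ) (p p' : JetInf n m) :
    dilate B t (p + p') = dilate B t p + dilate B t p' := by
  ext w
  by_cases hw : w ∈ B <;> simp [dilate, hw, mul_add]

theorem dilate_smul (B : Set (EvenCoord n m)) (t c : ℝ) (p : JetInf n m) :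
    dilate B t (c • p) = c • dilate B t p := by
  ext w
  by_cases hw : w ∈ B <;> simp [dilate, hw, mul_left_comm]

open Classical in
theorem hasLineDerivAt_dilate (B : Set (EvenCoord n m)) (z : EvenCoord n m) (t : ℝ)
    (f : SmoothFun n m) (p : JetInf n m) :
    HasLineDerivAt ℝ (fun p => f.1 (dilate B t p))
      ((if z ∈ B then t else 1) * (evenPartial z f).1 (dilate B t p)) p (Pi.single z 1) := by
  have h := (hasLineDerivAt_evenPartial z f (dilate B t p)).smul (if z ∈ B then t else 1)
  rw [smul_eq_mul, ← dilate_single] at h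
  unfold HasLineDerivAt at h ⊢
  simpa [dilate_add, dilate_smul] using h

theorem evenPartial_restrict (B : Set (EvenCoord n m)) {z : EvenCoord n m} (hz : z ∈ B)
    (f : SmoothFun n m) : evenPartial z (restrict B f) = 0 := by
  classical
  refine SmoothFun.ext fun p => evenPartial_apply_eq ?_
  have h := hasLineDerivAt_dilate B z 0 f p
  rw [if_pos hz, zero_mul] at h
  exact h

-- Differentiating `f (dilate B t p)` along a dilated coordinate produces a factor `t`, which raises
-- the weight by one.
open Classical in
theorem evenPartial_average (B : Set (EvenCoord n m)) (z : EvenCoord n m) (k : ℕ)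
    (f : SmoothFun n m) :
    evenPartial z (average B k f) = average B (if z ∈ B then k + 1 else k) (evenPartial z f) := by
  refine SmoothFun.ext fun p => ?_
  obtain ⟨r, g, hg, h⟩ := exists_dilate_eq B f
  have hG : ContDiff ℝ ∞ fun z : ℝ × Jet n m r => z.1 ^ k * g z := (contDiff_fst.pow k).mul hg
  have hF : ContDiff ℝ ∞ fun q => ∫ t in (0 : ℝ)..1, t ^ k * g (t, q) :=
    contDiff_infty.2 fun j => contDiff_intervalIntegral j hG
  have h1 := evenPartial_eq_fderiv (f := average B k f) hF
    (fun p => by simp only [average_apply, h]) z p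
  rw [(hasFDerivAt_intervalIntegral_of_contDiff (hG.of_le (by simp)) _).fderiv,
    ContinuousLinearMap.intervalIntegral_apply] at h1
  · rw [h1, average_apply]
    refine intervalIntegral.integral_congr fun t _ => ?_
    have h2 : HasLineDerivAt ℝ (fun p => t ^ k * f.1 (dilate B t p))
        (t ^ k * ((if z ∈ B then t else 1) * (evenPartial z f).1 (dilate B t p))) p (Pi.single z 1) :=
      HasDerivAt.const_mul (t ^ k) (hasLineDerivAt_dilate B z t f p)
    have hGt : ContDiff ℝ ∞ fun q => t ^ k * g (t, q) := hG.comp (contDiff_prodMk_right t)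
    have h3 := hasLineDerivAt_of_smooth hGt (f := fun p => t ^ k * f.1 (dilate B t p))
      (fun p => by simp only [h]) p (Pi.single z 1)
    have h4 := (((hG.differentiable (by simp)) (t, proj r p)).hasFDerivAt.comp (proj r p)
      (hasFDerivAt_prodMk_right t (proj r p))).fderiv
    have h5 := h3.unique h2
    change fderiv ℝ ((fun z : ℝ × Jet n m r => z.1 ^ k * g z) ∘ fun q => (t, q)) _ _ = _ at h5
    rw [h4] at h5
    change (_ : ℝ) = _
    rw [h5]
    split_ifs <;> ring
  · refine Continuous.intervalIntegrable ?_ _ _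
    exact ((hG.continuous_fderiv (by simp)).comp (by fun_prop)).clm_comp continuous_const

open Classical in
theorem average_evenCoord_mul (B : Set (EvenCoord n m)) (z : EvenCoord n m) (k : ℕ)
    (f : SmoothFun n m) :
    average B k (evenCoord z * f) = evenCoord z * average B (if z ∈ B then k + 1 else k) f := by
  refine SmoothFun.ext fun p => ?_
  change ∫ t in (0 : ℝ)..1, t ^ k * (dilate B t p z * f.1 (dilate B t p)) =
    p z * ∫ t in (0 : ℝ)..1, t ^ _ * f.1 (dilate B t p)
  rw [← intervalIntegral.integral_const_mul]
  refine intervalIntegral.integral_congr fun t _ => ?_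
  by_cases hz : z ∈ B <;> simp [dilate, hz] <;> ring

/-- The chain rule along a dilation orbit. `S` need only contain the coordinates of `B` on which `f`
depends, so the sum is finite even though `B` may be infinite. -/
theorem hasDerivAt_dilate (B : Set (EvenCoord n m)) (S : Finset (EvenCoord n m))
    (hSB : ∀ z ∈ S, z ∈ B) (f : SmoothFun n m)
    (hS : ∀ z ∈ B, evenPartial z f ≠ 0 → z ∈ S) (p : JetInf n m) (t : ℝ) :
    HasDerivAt (fun t => f.1 (dilate B t p))
      (∑ z ∈ S, p z * (evenPartial z f).1 (dilate B t p)) t := by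
  classical
  obtain ⟨r, g, hg, h⟩ := f.exists_rep
  have hd : HasDerivAt (fun t => proj r (dilate B t p))
      (fun w => if w.1 ∈ B then p w.1 else 0) t := by
    refine hasDerivAt_pi.2 fun w => ?_
    by_cases hw : w.1 ∈ B
    · simpa [proj, dilate, hw] using (hasDerivAt_id t).mul_const (p w.1)
    · simpa [proj, dilate, hw] using hasDerivAt_const t (p w.1)
  have h1 := ((hg.differentiable (by simp))
    (proj r (dilate B t p))).hasFDerivAt.comp_hasDerivAt t hd
  simp only [h]
  refine h1.congr_deriv ?_
  have hsum : (fun w : JetCoord n m r => if w.1 ∈ B then p w.1 else 0) =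
      ∑ w : JetCoord n m r, (if w.1 ∈ B then p w.1 else 0) • proj r (Pi.single w.1 1) := by
    ext w
    rw [Finset.sum_apply, Finset.sum_eq_single w]
    · simp [proj]
    · intro b _ hb
      simp [proj, Pi.single_eq_of_ne (fun h => hb (Subtype.ext h.symm))]
    · simp
  rw [hsum, map_sum]
  simp only [map_smul, ← evenPartial_eq_fderiv hg h, smul_eq_mul]
  have hord : ∀ z, evenPartial z f ≠ 0 → z.order ≤ r := by
    intro z hz
    by_contra hlt
    refine hz (SmoothFun.ext fun p => ?_)
    rw [evenPartial_eq_fderiv hg h, show proj r (Pi.single z (1 : ℝ)) = 0 from funext fun w =>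
      Pi.single_eq_of_ne (fun h : w.1 = z => hlt (h ▸ w.2)) _, map_zero]
    rfl
  -- The sum over jet coordinates and the sum over `S` are both compared with the `finsum` of `G`,
  -- whose support lies in either index set.
  set G : EvenCoord n m → ℝ := fun z =>
    (if z ∈ B then p z else 0) * (evenPartial z f).1 (dilate B t p) with hG
  have hne : ∀ z, G z ≠ 0 → z ∈ B ∧ evenPartial z f ≠ 0 := by
    intro z hz
    refine ⟨by_contra fun hB => hz (by simp [hG, hB]), fun h0 => hz ?_⟩
    rw [hG]
    simp only [h0]
    exact mul_zero _
  have h2 : ∑ z ∈ S, p z * (evenPartial z f).1 (dilate B t p) = ∑ᶠ z, G z := by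
    rw [finsum_eq_sum_of_support_subset G (s := S) fun z hz =>
      hS z (hne z hz).1 (hne z hz).2]
    exact Finset.sum_congr rfl fun z hz => by simp only [hG, hSB z hz, if_true]
  have h3 : ∑ w : JetCoord n m r, G w.1 = ∑ᶠ z, G z := by
    rw [finsum_eq_sum_of_support_subset G
      (s := Finset.univ.map (Function.Embedding.subtype fun z : EvenCoord n m => z.order ≤ r))
      fun z hz => ?_, Finset.sum_map]
    · rfl
    · simpa using hord z (hne z hz).2
  rw [h2, ← h3]

theorem SmoothFun.sum_apply {ι : Type} (S : Finset ι) (F : ι → SmoothFun n m) (p : JetInf n m) :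
    (∑ i ∈ S, F i).1 p = ∑ i ∈ S, (F i).1 p := by
  classical
  induction S using Finset.induction_on with
  | empty => rfl
  | insert a S ha ih =>
    rw [Finset.sum_insert ha, Finset.sum_insert ha, ← ih]
    rfl

/-- Fundamental theorem of calculus for `t ↦ f (dilate B t p)` on `[0,1]`. -/
theorem sum_evenCoord_mul_average (B : Set (EvenCoord n m)) (S : Finset (EvenCoord n m))
    (hSB : ∀ z ∈ S, z ∈ B) (f : SmoothFun n m)
    (hS : ∀ z ∈ B, evenPartial z f ≠ 0 → z ∈ S) :
    ∑ z ∈ S, evenCoord z * average B 0 (evenPartial z f) = f - restrict B f := by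
  refine SmoothFun.ext fun p => ?_
  have h1 := fun t (_ : t ∈ Set.uIcc (0 : ℝ) 1) => hasDerivAt_dilate B S hSB f hS p t
  have hc := fun z => continuous_dilate B (evenPartial z f) p
  have h2 := intervalIntegral.integral_eq_sub_of_hasDerivAt h1
    (Continuous.intervalIntegrable (by fun_prop) _ _)
  rw [SmoothFun.sum_apply]
  change ∑ z ∈ S, p z * (∫ t in (0 : ℝ)..1, t ^ 0 * (evenPartial z f).1 (dilate B t p)) =
    f.1 p - f.1 (dilate B 0 p)
  simp only [pow_zero, one_mul, ← intervalIntegral.integral_const_mul]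
  rw [← intervalIntegral.integral_finsetSum, h2]
  · rw [show dilate B 1 p = p from funext fun z => by simp [dilate]]
  · exact fun z _ => ((hc z).const_mul _).intervalIntegrable _ _

/-- The same argument for `t^(k+1) f (dilate B t p)`: the power removes the endpoint `t = 0`, and
its derivative contributes the average of weight `k`. -/
theorem sum_evenCoord_mul_average_succ (B : Set (EvenCoord n m)) (S : Finset (EvenCoord n m))
    (hSB : ∀ z ∈ S, z ∈ B) (f : SmoothFun n m)
    (hS : ∀ z ∈ B, evenPartial z f ≠ 0 → z ∈ S) (k : ℕ) :
    ∑ z ∈ S, evenCoord z * average B (k + 1) (evenPartial z f) =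
      f - ((k : ℝ) + 1) • average B k f := by
  refine SmoothFun.ext fun p => ?_
  have hf := continuous_dilate B f p
  have hc := fun z => continuous_dilate B (evenPartial z f) p
  have h1 := fun t (_ : t ∈ Set.uIcc (0 : ℝ) 1) =>
    (hasDerivAt_pow (k + 1) t).mul (hasDerivAt_dilate B S hSB f hS p t)
  have hc1 : Continuous fun t : ℝ =>
      ((k + 1 : ℕ) : ℝ) * t ^ (k + 1 - 1) * f.1 (dilate B t p) :=
    ((continuous_pow _).const_mul _).mul hf
  have hc2 : Continuous fun t : ℝ =>
      t ^ (k + 1) * ∑ z ∈ S, p z * (evenPartial z f).1 (dilate B t p) := by fun_prop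
  have h2 := intervalIntegral.integral_eq_sub_of_hasDerivAt h1
    ((hc1.add hc2).intervalIntegrable _ _)
  rw [intervalIntegral.integral_add (hc1.intervalIntegrable _ _)
    (hc2.intervalIntegrable _ _)] at h2
  have h3 : ∫ t in (0 : ℝ)..1, t ^ (k + 1) *
      ∑ z ∈ S, p z * (evenPartial z f).1 (dilate B t p) =
      ∑ z ∈ S, p z * ∫ t in (0 : ℝ)..1, t ^ (k + 1) * (evenPartial z f).1 (dilate B t p) := by
    simp only [← intervalIntegral.integral_const_mul]
    rw [← intervalIntegral.integral_finsetSum]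
    · simp only [Finset.mul_sum, mul_left_comm]
    · exact fun z _ => (((continuous_pow _).mul (hc z)).const_mul _).intervalIntegrable _ _
  have h4 : ∫ t in (0 : ℝ)..1, ((k + 1 : ℕ) : ℝ) * t ^ (k + 1 - 1) * f.1 (dilate B t p) =
      ((k : ℝ) + 1) * ∫ t in (0 : ℝ)..1, t ^ k * f.1 (dilate B t p) := by
    rw [← intervalIntegral.integral_const_mul]
    simp [mul_assoc]
  have h5 : dilate B 1 p = p := by
    ext z
    simp [dilate]
  rw [h3, h4] at h2
  rw [SmoothFun.sum_apply]
  change ∑ z ∈ S, p z * (∫ t in (0 : ℝ)..1, t ^ (k + 1) * (evenPartial z f).1 (dilate B t p)) =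
    f.1 p - ((k : ℝ) + 1) * ∫ t in (0 : ℝ)..1, t ^ k * f.1 (dilate B t p)
  simp only [Pi.mul_apply, h5, one_pow, one_mul] at h2
  rw [eq_sub_iff_add_eq, add_comm, h2]
  simp

end GradedJet

/-! ### Forms with operator coefficients: differential, contraction, Cartan formula -/

namespace GradedJet

variable {n : ℕ} {V V' : Type} [AddCommGroup V] [Module ℝ V] [AddCommGroup V'] [Module ℝ V']

theorem HForm.sum_apply {ι : Type} {r : ℕ} (S : Finset ι) (φ : ι → HForm n r V)
    (v : Fin r → Fin n → ℝ) : (∑ i ∈ S, φ i) v = ∑ i ∈ S, φ i v := by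
  classical
  induction S using Finset.induction_on with
  | empty => rfl
  | insert a S ha ih =>
    rw [Finset.sum_insert ha, Finset.sum_insert ha, ← ih]
    rfl

/-- The operator `∑ u^λ D_λ` in the direction `u`. -/
def dirOp (D : Fin n → V →ₗ[ℝ] V) (u : Fin n → ℝ) : V →ₗ[ℝ] V := ∑ l, u l • D l

theorem dirOp_add (D : Fin n → V →ₗ[ℝ] V) (u w : Fin n → ℝ) :
    dirOp D (u + w) = dirOp D u + dirOp D w := by
  simp [dirOp, add_smul, Finset.sum_add_distrib]

theorem dirOp_smul (D : Fin n → V →ₗ[ℝ] V) (c : ℝ) (u : Fin n → ℝ) :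
    dirOp D (c • u) = c • dirOp D u := by
  simp [dirOp, mul_smul, Finset.smul_sum]

theorem wedgeD_apply (D : Fin n → V →ₗ[ℝ] V) {r : ℕ} (φ : HForm n r V)
    (v : Fin (r + 1) → Fin n → ℝ) :
    wedgeD D r φ v = ∑ i : Fin (r + 1), (-1 : ℤ) ^ (i : ℕ) • dirOp D (v i) (φ (i.removeNth v)) := by
  simp only [wedgeD, dirOp, LinearMap.sum_apply, HForm.sum_apply, LinearMap.comp_apply,
    AlternatingMap.alternatizeUncurryFinLM_apply, AlternatingMap.alternatizeUncurryFin_apply,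
    Finset.smul_sum]
  rw [Finset.sum_comm]
  rfl

/-- Two maps `T`, `T'` are allowed because averaging over the base changes its weight when it passes
through `∂_λ`. -/
theorem wedgeD_comp {T T' : V →ₗ[ℝ] V'} {D : Fin n → V →ₗ[ℝ] V} {D' : Fin n → V' →ₗ[ℝ] V'}
    (h : ∀ l x, T' (D l x) = D' l (T x)) {r : ℕ} (φ : HForm n r V) :
    T'.compAlternatingMap (wedgeD D r φ) = wedgeD D' r (T.compAlternatingMap φ) := by
  ext v
  simp [wedgeD_apply, dirOp, h]

theorem comp_wedgeD_eq_zero (T : V →ₗ[ℝ] V') (D : Fin n → V →ₗ[ℝ] V)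
    (h : ∀ l x, T (D l x) = 0) {r : ℕ} (φ : HForm n r V) :
    T.compAlternatingMap (wedgeD D r φ) = 0 := by
  ext v
  simp [wedgeD_apply, dirOp, h]

theorem wedgeD_congr (D D' : Fin n → V →ₗ[ℝ] V) {r : ℕ} (φ : HForm n r V)
    (h : ∀ l v, D l (φ v) = D' l (φ v)) : wedgeD D r φ = wedgeD D' r φ := by
  ext v
  simp [wedgeD_apply, dirOp, h]

/-- The second order operator in directions `u, w` is symmetric in them, so alternation kills it. -/
theorem wedgeD_wedgeD (D : Fin n → V →ₗ[ℝ] V) (hD : ∀ l k x, D l (D k x) = D k (D l x)) {r : ℕ}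
    (φ : HForm n r V) : wedgeD D (r + 1) (wedgeD D r φ) = 0 := by
  let F : (Fin n → ℝ) →ₗ[ℝ] (Fin n → ℝ) →ₗ[ℝ] HForm n r V :=
    LinearMap.mk₂ ℝ (fun u w => (dirOp D u ∘ₗ dirOp D w).compAlternatingMap φ)
      (fun _ _ _ => by ext; simp [dirOp_add])
      (fun _ _ _ => by ext; simp [dirOp_smul])
      (fun _ _ _ => by ext; simp [dirOp_add])
      (fun _ _ _ => by ext; simp [dirOp_smul])
  have hF : ∀ u w, F u w = F w u := by
    intro u w
    ext v
    simp only [F, LinearMap.mk₂_apply, LinearMap.compAlternatingMap_apply, LinearMap.comp_apply,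
      dirOp, LinearMap.sum_apply, LinearMap.smul_apply, map_sum, map_smul, Finset.smul_sum]
    rw [Finset.sum_comm]
    refine Finset.sum_congr rfl fun i _ => Finset.sum_congr rfl fun j _ => ?_
    rw [hD, smul_comm]
  rw [← AlternatingMap.alternatizeUncurryFin_alternatizeUncurryFinLM_comp_of_symmetric hF]
  ext v
  simp only [wedgeD_apply, AlternatingMap.alternatizeUncurryFin_apply, LinearMap.comp_apply,
    AlternatingMap.alternatizeUncurryFinLM_apply, map_sum, map_zsmul]
  rfl

/-- The contraction `φ ↦ ∑ P_λ (∂_λ ⌋ φ)`. -/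
def contract (P : Fin n → V →ₗ[ℝ] V) (r : ℕ) (φ : HForm n (r + 1) V) : HForm n r V :=
  ∑ l : Fin n, (P l).compAlternatingMap (φ.curryLeft (Pi.single l 1))

theorem contract_apply (P : Fin n → V →ₗ[ℝ] V) {r : ℕ} (φ : HForm n (r + 1) V)
    (v : Fin r → Fin n → ℝ) :
    contract P r φ v = ∑ l : Fin n, P l (φ (Fin.cons (Pi.single l 1) v)) := by
  simp only [contract, HForm.sum_apply]
  rfl

theorem dirOp_single (D : Fin n → V →ₗ[ℝ] V) (l : Fin n) : dirOp D (Pi.single l 1) = D l := by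
  rw [dirOp, Finset.sum_eq_single l]
  · simp
  · intro b _ hb; simp [hb]
  · simp

theorem contract_wedgeD_zero (D P : Fin n → V →ₗ[ℝ] V) (φ : HForm n 0 V) :
    contract P 0 (wedgeD D 0 φ) = (∑ l, P l ∘ₗ D l).compAlternatingMap φ := by
  ext v
  simp only [contract_apply, wedgeD_apply, LinearMap.compAlternatingMap_apply, LinearMap.sum_apply]
  refine Finset.sum_congr rfl fun l _ => ?_
  rw [Fin.sum_univ_one]
  simp [dirOp_single]

/-- The terms in which `D` passes to the left of `P` cancel between the two composites. The slot
filled by the contracting vector leaves `∑ P_l D_l`, and each of the other `r + 1` slots leaves one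
commutator `c`. It is used with `c = 1` (lowering), `c = -1` (multiplication by `x^λ`) and `c = 0`.
-/
theorem contract_wedgeD (D P : Fin n → V →ₗ[ℝ] V) (c : ℝ)
    (hc : ∀ l k x, P l (D k x) = D k (P l x) + if l = k then c • x else 0) {r : ℕ}
    (φ : HForm n (r + 1) V) :
    contract P (r + 1) (wedgeD D (r + 1) φ) + wedgeD D r (contract P r φ) =
      (∑ l, P l ∘ₗ D l).compAlternatingMap φ - (c * (r + 1)) • φ := by
  ext v
  have hP : ∀ l u x, P l (dirOp D u x) = dirOp D u (P l x) + (u l * c) • x := by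
    intro l u x
    simp only [dirOp, LinearMap.sum_apply, LinearMap.smul_apply, map_sum, map_smul, hc, smul_add,
      Finset.sum_add_distrib]
    simp [mul_smul]
  -- The sum over `l` reassembles `v i` in the first slot; moving it back to slot `i` costs the
  -- sign.
  have hcomp : ∀ i : Fin (r + 1), ∑ l, v i l • φ (Fin.cons (Pi.single l 1) (i.removeNth v)) =
      (-1 : ℤ) ^ (i : ℕ) • φ v := by
    intro i
    have h1 := (AlternatingMap.neg_one_pow_smul_map_insertNth φ i (v i) (i.removeNth v)).symm
    rw [Fin.insertNth_self_removeNth] at h1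
    rw [← h1]
    have h2 : v i = ∑ l, v i l • (Pi.single l 1 : Fin n → ℝ) := by
      ext k; simp [Pi.single_apply]
    have h4 : φ (Matrix.vecCons (v i) (i.removeNth v)) = φ.curryLeft (v i) (i.removeNth v) := rfl
    rw [h4]
    conv_rhs => rw [h2]
    rw [map_sum, HForm.sum_apply]
    refine Finset.sum_congr rfl fun l _ => ?_
    rw [map_smul]
    rfl
  simp only [AlternatingMap.add_apply, AlternatingMap.sub_apply, AlternatingMap.smul_apply,
    contract_apply, wedgeD_apply, LinearMap.compAlternatingMap_apply, LinearMap.sum_apply,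
    LinearMap.comp_apply, map_sum, map_zsmul]
  have h1 : ∀ l : Fin n, ∑ i : Fin (r + 2), (-1 : ℤ) ^ (i : ℕ) •
      P l (dirOp D ((Fin.cons (Pi.single l 1) v : Fin (r + 2) → Fin n → ℝ) i)
        (φ (i.removeNth (Fin.cons (Pi.single l 1) v : Fin (r + 2) → Fin n → ℝ)))) =
      P l (D l (φ v)) - ∑ i : Fin (r + 1), (-1 : ℤ) ^ (i : ℕ) •
        (dirOp D (v i) (P l (φ (Fin.cons (Pi.single l 1) (i.removeNth v)))) +
          (v i l * c) • φ (Fin.cons (Pi.single l 1) (i.removeNth v))) := by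
    intro l
    rw [Fin.sum_univ_succ, sub_eq_add_neg, ← Finset.sum_neg_distrib]
    congr 1
    · simp [dirOp_single]
    · refine Finset.sum_congr rfl fun i _ => ?_
      have : i.succ.removeNth (Fin.cons (Pi.single l 1) v : Fin (r + 2) → Fin n → ℝ) =
          Fin.cons (Pi.single l 1) (i.removeNth v) := by
        ext j : 1
        refine Fin.cases ?_ (fun j => ?_) j <;> simp [Fin.removeNth]
      rw [this, Fin.cons_succ, hP, Fin.val_succ, pow_succ]
      simp [add_comm]
  rw [Finset.sum_congr rfl fun l _ => h1 l, Finset.sum_sub_distrib, Finset.sum_comm]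
  have h2 : ∀ i : Fin (r + 1), ∑ l : Fin n, (-1 : ℤ) ^ (i : ℕ) •
        (dirOp D (v i) (P l (φ (Fin.cons (Pi.single l 1) (i.removeNth v)))) +
          (v i l * c) • φ (Fin.cons (Pi.single l 1) (i.removeNth v))) =
      (-1 : ℤ) ^ (i : ℕ) • ∑ l, dirOp D (v i) (P l (φ (Fin.cons (Pi.single l 1) (i.removeNth v))))
        + c • φ v := by
    intro i
    rw [← Finset.smul_sum, Finset.sum_add_distrib, smul_add]
    congr 1
    have : ∀ l : Fin n, (v i l * c) • φ (Fin.cons (Pi.single l 1) (i.removeNth v)) =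
        c • v i l • φ (Fin.cons (Pi.single l 1) (i.removeNth v)) := fun l => by
      rw [smul_smul, mul_comm]
    rw [Finset.sum_congr rfl fun l _ => this l, ← Finset.smul_sum, hcomp, smul_comm, smul_smul,
      ← mul_pow]
    simp
  rw [Finset.sum_congr rfl fun i _ => h2 i, Finset.sum_add_distrib]
  simp only [Finset.smul_sum, Finset.sum_const, Finset.card_univ, Fintype.card_fin]
  rw [← Nat.cast_smul_eq_nsmul ℝ, smul_smul]
  push_cast
  rw [mul_comm c]
  abel

end GradedJet

/-! ### Graded commutation relations and total derivatives -/

namespace GradedJet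

variable {n m q : ℕ}

theorem oddPartial_ι_mul (z : OddCoord n q) (v : OddCoord n q →₀ ℝ) (x : Grassmann n q) :
    oddPartial z (ExteriorAlgebra.ι ℝ v * x) = v z • x - ExteriorAlgebra.ι ℝ v * oddPartial z x :=
  CliffordAlgebra.contractLeft_ι_mul _ v x

theorem oddPartial_comm (z w : OddCoord n q) (x : Grassmann n q) :
    oddPartial z (oddPartial w x) = -oddPartial w (oddPartial z x) :=
  CliffordAlgebra.contractLeft_comm _ _ x

theorem oddPartial_one (z : OddCoord n q) : oddPartial z 1 = 0 :=
  CliffordAlgebra.contractLeft_one (Q := (0 : QuadraticForm ℝ (OddCoord n q →₀ ℝ))) _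

/-- The sign of the transposition of `s^A_Λ` and `s^B_Σ`. -/
def gsign : FibreCoord n m q → FibreCoord n m q → ℝ
  | (Sum.inr _, _), (Sum.inr _, _) => -1
  | _, _ => 1

theorem gsign_comm (k j : FibreCoord n m q) : gsign k j = gsign j k := by
  rcases k with ⟨_ | _, _⟩ <;> rcases j with ⟨_ | _, _⟩ <;> rfl

theorem gsign_cons (k j : FibreCoord n m q) (l : Fin n) :
    gsign k (j.1, j.2.cons l) = gsign k j := by
  rcases k with ⟨_ | _, _⟩ <;> rcases j with ⟨_ | _, _⟩ <;> rfl

theorem gsign_mul_self (k j : FibreCoord n m q) : gsign k j * gsign k j = 1 := by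
  rcases k with ⟨_ | _, _⟩ <;> rcases j with ⟨_ | _, _⟩ <;> simp [gsign]

-- The Leibniz rule is needed only for multiplication by a coordinate, so a sign depending on two
-- labels suffices and no parity decomposition of graded functions enters.
open Classical in
theorem fibrePartial_mul (k j : FibreCoord n m q) (u : GradedFun n m q) :
    fibrePartial k (fibreCoord j * u) =
      (if k = j then u else 0) + gsign k j • (fibreCoord j * fibrePartial k u) := by
  induction u using TensorProduct.induction_on with
  | zero => simp
  | add x y hx hy =>
    rw [mul_add, map_add, hx, hy, map_add, mul_add, smul_add]
    split_ifs <;> abel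
  | tmul f x =>
    rcases k with ⟨i | a, L⟩ <;> rcases j with ⟨i' | a', L'⟩
    · simp only [fibrePartial, fibreCoord, Algebra.TensorProduct.tmul_mul_tmul, one_mul,
        LinearMap.rTensor_tmul, evenPartial_mul, evenPartial_evenCoord, gsign, one_smul,
        TensorProduct.add_tmul, Sum.inr.injEq, Prod.mk.injEq, Sum.inl.injEq]
      split_ifs <;> simp
    · simp [fibrePartial, fibreCoord, gsign]
    · simp [fibrePartial, fibreCoord, gsign]
    · simp only [fibrePartial, fibreCoord, Algebra.TensorProduct.tmul_mul_tmul, one_mul,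
        LinearMap.lTensor_tmul, oddPartial_ι_mul, gsign, neg_smul, one_smul,
        Finsupp.single_apply, Prod.mk.injEq, Sum.inr.injEq,
        sub_eq_add_neg, TensorProduct.tmul_add, TensorProduct.tmul_neg]
      congr 1
      by_cases h : a' = a ∧ L' = L
      · rw [if_pos h, if_pos ⟨h.1.symm, h.2.symm⟩, one_smul]
      · rw [if_neg h, if_neg fun h' => h ⟨h'.1.symm, h'.2.symm⟩, zero_smul,
          TensorProduct.tmul_zero]

theorem basePartial_mul (l : Fin n) (j : FibreCoord n m q) (u : GradedFun n m q) :
    basePartial l (fibreCoord j * u) = fibreCoord j * basePartial l u := by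
  induction u using TensorProduct.induction_on with
  | zero => simp
  | add x y hx hy => rw [mul_add, map_add, hx, hy, map_add, mul_add]
  | tmul f x =>
    rcases j with ⟨i | a, L⟩
    · simp [basePartial, fibreCoord, evenPartial_mul, evenPartial_evenCoord]
    · simp [basePartial, fibreCoord]

theorem fibrePartial_comm (k j : FibreCoord n m q) (u : GradedFun n m q) :
    fibrePartial k (fibrePartial j u) = gsign k j • fibrePartial j (fibrePartial k u) := by
  induction u using TensorProduct.induction_on with
  | zero => simp
  | add x y hx hy => simp only [map_add, hx, hy, smul_add]
  | tmul f x =>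
    rcases k with ⟨i | a, L⟩ <;> rcases j with ⟨i' | a', L'⟩
    · simp [fibrePartial, gsign, evenPartial_comm (Sum.inr (i, L))]
    · simp [fibrePartial, gsign]
    · simp [fibrePartial, gsign]
    · simp [fibrePartial, gsign, oddPartial_comm (a, L), TensorProduct.tmul_neg]

theorem basePartial_fibrePartial (l : Fin n) (j : FibreCoord n m q) (u : GradedFun n m q) :
    basePartial l (fibrePartial j u) = fibrePartial j (basePartial l u) := by
  induction u using TensorProduct.induction_on with
  | zero => simp
  | add x y hx hy => simp only [map_add, hx, hy]
  | tmul f x =>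
    rcases j with ⟨i' | a', L'⟩
    · simp [fibrePartial, basePartial, evenPartial_comm (Sum.inl l)]
    · simp [fibrePartial, basePartial]

theorem basePartial_comm (l k : Fin n) (u : GradedFun n m q) :
    basePartial l (basePartial k u) = basePartial k (basePartial l u) := by
  induction u using TensorProduct.induction_on with
  | zero => simp
  | add x y hx hy => simp only [map_add, hx, hy]
  | tmul f x => simp [basePartial, evenPartial_comm (Sum.inl l)]

theorem ι_mul_ι_comm (v w : OddCoord n q →₀ ℝ) (x : Grassmann n q) :
    ExteriorAlgebra.ι ℝ v * (ExteriorAlgebra.ι ℝ w * x) =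
      -(ExteriorAlgebra.ι ℝ w * (ExteriorAlgebra.ι ℝ v * x)) := by
  rw [← mul_assoc, ← mul_assoc, ← neg_mul]
  congr 1
  exact eq_neg_of_add_eq_zero_left (ExteriorAlgebra.ι_add_mul_swap v w)

theorem fibreCoord_comm (k j : FibreCoord n m q) (u : GradedFun n m q) :
    fibreCoord k * (fibreCoord j * u) = gsign k j • (fibreCoord j * (fibreCoord k * u)) := by
  induction u using TensorProduct.induction_on with
  | zero => simp
  | add x y hx hy => simp only [mul_add, hx, hy, smul_add]
  | tmul f x =>
    rcases k with ⟨i | a, L⟩ <;> rcases j with ⟨i' | a', L'⟩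
    · simp [fibreCoord, gsign, mul_left_comm]
    · simp [fibreCoord, gsign]
    · simp [fibreCoord, gsign]
    · simp [fibreCoord, gsign, ι_mul_ι_comm (Finsupp.single (a, L) 1), TensorProduct.tmul_neg]

/-! ### Contact forms -/

section Contact

variable {V : Type} [AddCommGroup V] [Module ℝ V]

theorem Contact.lift_theta (T : FibreCoord n m q → GradedFun n m q →ₗ[ℝ] V)
    (k : FibreCoord n m q) (u : GradedFun n m q) : Contact.lift T (Contact.theta k u) = T k u :=
  Finsupp.lsum_single ℝ T k u

@[elab_as_elim]
theorem Contact.induction {P : Contact n m q → Prop} (x : Contact n m q) (zero : P 0)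
    (add : ∀ x y, P x → P y → P (x + y)) (theta : ∀ k u, P (Contact.theta k u)) : P x :=
  Finsupp.induction_linear (motive := P) x zero (fun _ _ => add _ _) theta

theorem Contact.hom_ext {S T : Contact n m q →ₗ[ℝ] V}
    (h : ∀ k u, S (Contact.theta k u) = T (Contact.theta k u)) : S = T := by
  refine LinearMap.ext fun x => ?_
  induction x using Contact.induction with
  | zero => rw [map_zero, map_zero]
  | add x y hx hy => rw [map_add, map_add, hx, hy]
  | theta k u => exact h k u

/-- The finite set of fibre coordinates on which a graded function depends. -/
def fibreSupport (f : GradedFun n m q) : Finset (FibreCoord n m q) :=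
  (fibrePartial_finite f).toFinset

theorem mem_fibreSupport {f : GradedFun n m q} {k : FibreCoord n m q} :
    k ∈ fibreSupport f ↔ fibrePartial k f ≠ 0 := by simp [fibreSupport]

/-- Allowing any `S` above the support lets several functions be summed over one index set. -/
theorem Contact.lift_eq_sum (T : FibreCoord n m q → GradedFun n m q →ₗ[ℝ] V)
    {f : GradedFun n m q} {S : Finset (FibreCoord n m q)} (hS : fibreSupport f ⊆ S) :
    Contact.lift T (vertFun f) = ∑ k ∈ S, T k (fibrePartial k f) := by
  have h : Contact.lift T (vertFun f) =
      (Finsupp.ofSupportFinite (fun k => fibrePartial k f) (fibrePartial_finite f)).sum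
        fun k u => T k u := rfl
  rw [h]
  refine Finsupp.sum_of_support_subset _ (fun k hk => hS ?_) _ (fun k _ => map_zero _)
  rw [mem_fibreSupport]
  exact Finsupp.mem_support_iff.1 hk

theorem vertFun_eq_sum {f : GradedFun n m q} {S : Finset (FibreCoord n m q)}
    (hS : fibreSupport f ⊆ S) : vertFun f = ∑ k ∈ S, Contact.theta k (fibrePartial k f) := by
  rw [← Contact.lift_eq_sum _ hS]
  have : Contact.lift (V := Contact n m q) Contact.theta = LinearMap.id :=
    Contact.hom_ext fun k u => Contact.lift_theta _ _ _
  rw [this, LinearMap.id_apply]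

theorem coeffs_vertFun (f : GradedFun n m q) (k : FibreCoord n m q) :
    Contact.coeffs n m q (vertFun f) k = fibrePartial k f := rfl

theorem vertFun_eq_zero_iff {f : GradedFun n m q} :
    vertFun f = 0 ↔ ∀ k, fibrePartial k f = 0 := by
  constructor
  · intro h k
    rw [← coeffs_vertFun, h]
    rfl
  · intro h
    exact (Contact.coeffs n m q).injective (Finsupp.ext fun k => h k)

theorem totalDeriv_eq_sum (l : Fin n) {f : GradedFun n m q} {S : Finset (FibreCoord n m q)}
    (hS : fibreSupport f ⊆ S) : totalDeriv l f =
      basePartial l f + ∑ k ∈ S, fibreCoord (k.1, k.2.cons l) * fibrePartial k f := by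
  rw [totalDeriv, LinearMap.add_apply, LinearMap.comp_apply, Contact.lift_eq_sum _ hS]
  rfl

theorem totalDeriv_of_vertFun_eq_zero (l : Fin n) {f : GradedFun n m q} (h : vertFun f = 0) :
    totalDeriv l f = basePartial l f := by
  rw [totalDeriv, LinearMap.add_apply, LinearMap.comp_apply, h, map_zero, add_zero]

theorem totalDerivContact_theta (l : Fin n) (k : FibreCoord n m q) (u : GradedFun n m q) :
    totalDerivContact l (Contact.theta k u) =
      Contact.theta (k.1, k.2.cons l) u + Contact.theta k (totalDeriv l u) := by
  rw [totalDerivContact, Contact.lift_theta]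
  rfl

theorem Contact.sum_theta_apply (S : Finset (FibreCoord n m q))
    (c : FibreCoord n m q → FibreCoord n m q)
    (u : FibreCoord n m q → GradedFun n m q) (k : FibreCoord n m q)
    [DecidableEq (FibreCoord n m q)] :
    Contact.coeffs n m q (∑ j ∈ S, Contact.theta (c j) (u j)) k =
      ∑ j ∈ S, if k = c j then u j else 0 := by
  rw [map_sum, Finsupp.finsetSum_apply]
  refine Finset.sum_congr rfl fun j _ => ?_
  change (Finsupp.single (c j) (u j)) k = _
  rw [Finsupp.single_apply]
  simp only [eq_comm]

/-- When `∂^Λ_A` meets `d_l f`, it either differentiates a coefficient `s_{l+Σ}`, which produces the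
raised `θ_{l+Σ}`, or passes through to `f`. -/
theorem vertFun_totalDeriv (l : Fin n) (f : GradedFun n m q) :
    vertFun (totalDeriv l f) = totalDerivContact l (vertFun f) := by
  classical
  set S := fibreSupport f with hS
  refine (Contact.coeffs n m q).injective (Finsupp.ext fun k => ?_)
  rw [coeffs_vertFun, totalDeriv_eq_sum l (S := S) subset_rfl, vertFun_eq_sum (S := S) subset_rfl,
    map_sum]
  simp only [totalDerivContact_theta, Finset.sum_add_distrib]
  rw [(Contact.coeffs n m q).map_add, Finsupp.add_apply,
    Contact.sum_theta_apply S (fun j => (j.1, j.2.cons l)),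
    Contact.sum_theta_apply S (fun j => j)]
  simp only [map_add, map_sum, fibrePartial_mul, Finset.sum_add_distrib]
  rw [← basePartial_fibrePartial, add_left_comm]
  congr 1
  have h1 : ∑ j ∈ S, (if k = j then totalDeriv l (fibrePartial j f) else 0) =
      totalDeriv l (fibrePartial k f) := by
    rw [Finset.sum_ite_eq]
    split_ifs with hk
    · rfl
    · rw [hS, mem_fibreSupport, not_not] at hk
      rw [hk, map_zero]
  rw [h1, totalDeriv_eq_sum l (S := S)]
  · congr 1
    refine Finset.sum_congr rfl fun j _ => ?_
    -- Passing the coefficient `s_{l+j}` and passing `∂_j` cost the same sign, so the signs cancel.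
    rw [gsign_cons, fibrePartial_comm k j, mul_smul_comm, smul_smul, gsign_mul_self, one_smul]
  · intro j hj
    rw [mem_fibreSupport] at hj ⊢
    rw [fibrePartial_comm j k] at hj
    exact fun h0 => hj (by rw [h0, map_zero, smul_zero])

theorem totalDeriv_fibreCoord_mul (l : Fin n) (k : FibreCoord n m q) (u : GradedFun n m q) :
    totalDeriv l (fibreCoord k * u) =
      fibreCoord (k.1, k.2.cons l) * u + fibreCoord k * totalDeriv l u := by
  classical
  set S := fibreSupport (fibreCoord k * u) ∪ (fibreSupport u ∪ {k}) with hS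
  rw [totalDeriv_eq_sum l (S := S) Finset.subset_union_left,
    totalDeriv_eq_sum l (f := u) (S := S)
      (Finset.subset_union_left.trans Finset.subset_union_right)]
  simp only [fibrePartial_mul, mul_add, Finset.sum_add_distrib, mul_ite, mul_zero]
  rw [Finset.sum_ite_eq', if_pos (by simp [hS]), basePartial_mul, add_left_comm, Finset.mul_sum]
  congr 2
  refine Finset.sum_congr rfl fun j _ => ?_
  rw [mul_smul_comm, fibreCoord_comm, smul_smul, gsign_comm (j.1, j.2.cons l) k, gsign_cons,
    gsign_comm j,
    gsign_mul_self, one_smul]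

theorem basePartial_totalDeriv (l k : Fin n) (f : GradedFun n m q) :
    basePartial l (totalDeriv k f) = totalDeriv k (basePartial l f) := by
  rw [totalDeriv_eq_sum k (S := fibreSupport f) subset_rfl,
    totalDeriv_eq_sum k (f := basePartial l f) (S := fibreSupport f)]
  · simp only [map_add, map_sum, basePartial_mul, basePartial_fibrePartial, basePartial_comm l]
  · intro j hj
    rw [mem_fibreSupport] at hj ⊢
    exact fun h0 => hj (by rw [← basePartial_fibrePartial, h0, map_zero])

/-- The non-base part of `d_k` is `d_V` followed by `θ_j u ↦ s_{k+j} u`, and this substitution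
intertwines the two actions of `d_l`, up to an exchange of `k` and `l` in the jet index. -/
theorem totalDeriv_comm (l k : Fin n) (f : GradedFun n m q) :
    totalDeriv l (totalDeriv k f) = totalDeriv k (totalDeriv l f) := by
  have h : ∀ x : Contact n m q,
      totalDeriv l (Contact.lift (fun j => LinearMap.mulLeft ℝ (fibreCoord (j.1, j.2.cons k))) x) =
        Contact.lift (fun j => LinearMap.mulLeft ℝ (fibreCoord (j.1, j.2.cons k)))
          (totalDerivContact l x) := by
    intro x
    induction x using Contact.induction with
    | zero => simp only [map_zero]
    | add x y hx hy => simp only [map_add, hx, hy]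
    | theta j u =>
      simp only [totalDerivContact_theta, map_add, Contact.lift_theta, LinearMap.mulLeft_apply,
        totalDeriv_fibreCoord_mul, MultiIndex.cons]
      rw [add_right_comm]
  have h2 : ∀ g : GradedFun n m q, totalDeriv k g = basePartial k g +
      Contact.lift (fun j => LinearMap.mulLeft ℝ (fibreCoord (j.1, j.2.cons k))) (vertFun g) :=
    fun _ => rfl
  rw [h2, h2, map_add, h, vertFun_totalDeriv, basePartial_totalDeriv]

theorem totalDerivContact_comm (l k : Fin n) (x : Contact n m q) :
    totalDerivContact l (totalDerivContact k x) = totalDerivContact k (totalDerivContact l x) := by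
  induction x using Contact.induction with
  | zero => simp only [map_zero]
  | add x y hx hy => simp only [map_add, hx, hy]
  | theta j u =>
    simp only [totalDerivContact_theta, map_add, MultiIndex.cons, totalDeriv_comm l k]
    rw [add_right_comm j.2]
    abel

end Contact

/-! ### Iterated total derivatives and `ϱ` -/

theorem _root_.List.prod_ofFn_pow_add_single {M : Type*} [Monoid M] {n : ℕ} (f : Fin n → M)
    (hf : ∀ i j, Commute (f i) (f j)) (L : Fin n →₀ ℕ) (i : Fin n) :
    (List.ofFn fun j => f j ^ (L + Finsupp.single i 1 : Fin n →₀ ℕ) j).prod =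
      (List.ofFn fun j => f j ^ L j).prod * f i := by
  have key : ∀ {n : ℕ} (f : Fin n → M) (_ : ∀ i j, Commute (f i) (f j)) (L : Fin n → ℕ)
      (i : Fin n), (List.ofFn fun j => f j ^ (L j + (Pi.single i 1 : Fin n → ℕ) j)).prod =
        (List.ofFn fun j => f j ^ L j).prod * f i := by
    intro n
    induction n with
    | zero => exact fun _ _ _ i => i.elim0
    | succ n ih =>
      intro f hf L i
      rw [List.ofFn_succ, List.ofFn_succ, List.prod_cons, List.prod_cons]
      refine Fin.cases ?_ (fun i => ?_) i
      · have hc : Commute (List.ofFn fun j : Fin n => f j.succ ^ L j.succ).prod (f 0) := by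
          refine (Commute.list_prod_right _ _ fun x hx => ?_).symm
          obtain ⟨j, rfl⟩ := List.mem_ofFn.1 hx
          exact (hf 0 _).pow_right _
        rw [mul_assoc, hc.eq, ← mul_assoc, Pi.single_eq_same, pow_succ]
        simp
      · have h0 : (Pi.single i.succ 1 : Fin (n + 1) → ℕ) 0 = 0 :=
          Pi.single_eq_of_ne (Fin.succ_ne_zero i).symm _
        have h1 : ∀ j : Fin n, (Pi.single i.succ 1 : Fin (n + 1) → ℕ) j.succ =
            (Pi.single i 1 : Fin n → ℕ) j := fun j => by
          simp [Pi.single_apply]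
        simp only [h0, h1, add_zero]
        rw [ih (fun j => f j.succ) (fun _ _ => hf _ _) (fun j => L j.succ) i, mul_assoc]
  rw [← key f hf]
  simp only [Finsupp.add_apply, Finsupp.single_eq_pi_single]

theorem iterTotalDeriv_cons (L : MultiIndex n) (l : Fin n) (u : GradedFun n m q) :
    iterTotalDeriv (L.cons l) u = iterTotalDeriv L (totalDeriv l u) := by
  have h := List.prod_ofFn_pow_add_single
    (fun l : Fin n => (totalDeriv l : Module.End ℝ (GradedFun n m q)))
    (fun i j => LinearMap.ext (totalDeriv_comm i j)) L l
  exact LinearMap.congr_fun h u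

theorem iterTotalDeriv_zero (u : GradedFun n m q) : iterTotalDeriv 0 u = u := by
  simp [iterTotalDeriv]

theorem rhoContact_theta (k : FibreCoord n m q) (u : GradedFun n m q) :
    rhoContact n m q (Contact.theta k u) =
      ((-1 : ℝ) ^ k.2.degree) • Contact.theta (k.1, 0) (iterTotalDeriv k.2 u) := by
  rw [rhoContact, Contact.lift_theta]
  rfl

theorem degree_cons (L : MultiIndex n) (l : Fin n) : (L.cons l).degree = L.degree + 1 := by
  simp [MultiIndex.cons]

/-- Both terms of `D_l(θ_Λ u)` are sent to `θ d_{l+Λ} u`, with opposite signs because their jet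
orders differ by one. -/
theorem rhoContact_totalDerivContact (l : Fin n) (x : Contact n m q) :
    rhoContact n m q (totalDerivContact l x) = 0 := by
  induction x using Contact.induction with
  | zero => simp only [map_zero]
  | add x y hx hy => simp only [map_add, hx, hy, add_zero]
  | theta k u =>
    simp only [totalDerivContact_theta, map_add, rhoContact_theta, iterTotalDeriv_cons,
      degree_cons, pow_succ]
    simp

end GradedJet

/-! ### Exactness of the one-contact complex -/

namespace GradedJet

variable {n m q : ℕ}

section Values

variable {V : Type} [AddCommGroup V] [Module ℝ V]

theorem HForm.mem_of_forall_single {r : ℕ} (S : Submodule ℝ V) (φ : HForm n r V)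
    (h : ∀ v : Fin r → Fin n, φ (fun i => Pi.single (v i) 1) ∈ S) (w : Fin r → Fin n → ℝ) :
    φ w ∈ S := by
  have h0 : (S.mkQ.compAlternatingMap φ).toMultilinearMap = 0 := by
    refine Module.Basis.ext_multilinear (fun _ => Pi.basisFun ℝ (Fin n)) fun v => ?_
    simpa using h v
  have h1 : S.mkQ (φ w) = 0 := congrArg (fun f : MultilinearMap ℝ _ _ => f w) h0
  simpa using h1

/-- A form is determined by finitely many coefficients, so one level of the filtration holds all its
values. This serves both for the jet order and for the odd degree. -/
theorem HForm.exists_forall_mem {r : ℕ} (F : ℕ → Submodule ℝ V) (hF : Monotone F)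
    (hex : ∀ x, ∃ K, x ∈ F K) (φ : HForm n r V) : ∃ K, ∀ w, φ w ∈ F K := by
  choose K hK using fun v : Fin r → Fin n => hex (φ fun i => Pi.single (v i) 1)
  exact ⟨Finset.univ.sup K, HForm.mem_of_forall_single _ φ fun v =>
    hF (Finset.le_sup (Finset.mem_univ v)) (hK v)⟩

instance HForm.subsingleton : Subsingleton (HForm n (n + 1) V) := by
  refine ⟨fun φ ψ => ?_⟩
  have h : φ.toMultilinearMap = ψ.toMultilinearMap := by
    refine Module.Basis.ext_multilinear (fun _ => Pi.basisFun ℝ (Fin n)) fun v => ?_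
    obtain ⟨i, j, hij, hv⟩ := Fintype.exists_ne_map_eq_of_card_lt v (by simp)
    have hv' : (Pi.basisFun ℝ (Fin n)) (v i) = (Pi.basisFun ℝ (Fin n)) (v j) := by rw [hv]
    exact (φ.map_eq_zero_of_eq _ hv' hij).trans (ψ.map_eq_zero_of_eq _ hv' hij).symm
  exact AlternatingMap.coe_multilinearMap_injective h

end Values

/-- The operator `θ^A_Λ f ↦ Λ_λ θ^A_{Λ-λ} f`. -/
def lowerContact (l : Fin n) : Contact n m q →ₗ[ℝ] Contact n m q :=
  Contact.lift fun k => (k.2 l : ℝ) • Contact.theta (k.1, k.2 - Finsupp.single l 1)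

theorem lowerContact_theta (l : Fin n) (k : FibreCoord n m q) (u : GradedFun n m q) :
    lowerContact l (Contact.theta k u) =
      (k.2 l : ℝ) • Contact.theta (k.1, k.2 - Finsupp.single l 1) u := by
  rw [lowerContact, Contact.lift_theta]
  rfl

/-- A Weyl relation: on the labels, lowering behaves like `∂/∂ξ_a` and raising like multiplication
by `ξ_b`, while the action of `d_b` on coefficients commutes with lowering. -/
theorem lowerContact_totalDerivContact (a b : Fin n) (x : Contact n m q) :
    lowerContact a (totalDerivContact b x) =
      totalDerivContact b (lowerContact a x) + if a = b then (1 : ℝ) • x else 0 := by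
  induction x using Contact.induction with
  | zero => simp only [map_zero, smul_zero, ite_self, add_zero]
  | add x y hx hy =>
    simp only [map_add, hx, hy, smul_add]
    split_ifs <;> abel
  | theta k u =>
    simp only [totalDerivContact_theta, lowerContact_theta, map_add, map_smul, smul_add,
      MultiIndex.cons, one_smul]
    rw [add_right_comm _ _ (if a = b then _ else _)]
    congr 1
    -- Truncated subtraction is harmless when `Λ_a = 0`, since the coefficient `Λ_a` vanishes as
    -- well.
    by_cases hk : k.2 a = 0
    · by_cases hab : a = b
      · subst hab
        simp [hk]
      · simp [hk, hab]
    · have hle : Finsupp.single a 1 ≤ k.2 := by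
        rw [Finsupp.single_le_iff]
        exact Nat.one_le_iff_ne_zero.2 hk
      rw [tsub_add_eq_add_tsub hle]
      by_cases hab : a = b
      · subst hab
        simp [add_smul]
      · simp [hab]

/-- One-contact one-forms of jet order less than `K`. -/
def contactLT (n m q K : ℕ) : Submodule ℝ (Contact n m q) :=
  Submodule.span ℝ {x | ∃ k u, k.2.degree < K ∧ Contact.theta k u = x}

theorem theta_mem_contactLT {K : ℕ} {k : FibreCoord n m q} (hk : k.2.degree < K)
    (u : GradedFun n m q) : Contact.theta k u ∈ contactLT n m q K :=
  Submodule.subset_span ⟨k, u, hk, rfl⟩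

theorem contactLT_mono : Monotone (contactLT n m q) := fun _ _ h =>
  Submodule.span_mono fun _ ⟨k, u, hk, hx⟩ => ⟨k, u, hk.trans_le h, hx⟩

theorem contactLT_zero : contactLT n m q 0 = ⊥ := by
  simp [contactLT]

theorem exists_mem_contactLT (x : Contact n m q) : ∃ K, x ∈ contactLT n m q K := by
  induction x using Contact.induction with
  | zero => exact ⟨0, zero_mem _⟩
  | add x y hx hy =>
    obtain ⟨K, hK⟩ := hx
    obtain ⟨L, hL⟩ := hy
    exact ⟨max K L, add_mem (contactLT_mono (le_max_left _ _) hK)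
      (contactLT_mono (le_max_right _ _) hL)⟩
  | theta k u => exact ⟨_, theta_mem_contactLT (Nat.lt_succ_self _) u⟩

theorem sum_lowerContact_totalDerivContact_theta (k : FibreCoord n m q) (u : GradedFun n m q) :
    (∑ l, lowerContact l ∘ₗ totalDerivContact l) (Contact.theta k u) =
      ((k.2.degree : ℝ) + n) • Contact.theta k u +
        ∑ l, (k.2 l : ℝ) • Contact.theta (k.1, k.2 - Finsupp.single l 1) (totalDeriv l u) := by
  simp only [LinearMap.sum_apply, LinearMap.comp_apply, totalDerivContact_theta, map_add,
    lowerContact_theta, MultiIndex.cons, add_tsub_cancel_right, Finset.sum_add_distrib,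
    ← Finset.sum_smul]
  congr 2
  simp [Finsupp.degree_eq_sum, Finset.sum_add_distrib]

/-- On `θ_Λ u` the diagonal part is the scalar `|Λ| + n`; the other terms carry `θ_{Λ-l}`, one order
lower. -/
theorem sum_lowerContact_sub_mem {K : ℕ} {x : Contact n m q} (hx : x ∈ contactLT n m q (K + 1)) :
    (∑ l, lowerContact l ∘ₗ totalDerivContact l) x - ((K : ℝ) + n) • x ∈ contactLT n m q K := by
  induction hx using Submodule.span_induction with
  | zero => simp
  | add x y _ _ hx hy =>
    rw [map_add, smul_add, add_sub_add_comm]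
    exact add_mem hx hy
  | smul c x _ hx =>
    rw [map_smul, smul_comm _ c, ← smul_sub]
    exact Submodule.smul_mem _ c hx
  | mem x hx =>
    obtain ⟨k, u, hk, rfl⟩ := hx
    rw [sum_lowerContact_totalDerivContact_theta, add_sub_right_comm, ← sub_smul]
    refine add_mem ?_ (Submodule.sum_mem _ fun l _ => ?_)
    · rcases (Nat.lt_succ_iff.1 hk).eq_or_lt with h | h
      · rw [h, sub_self, zero_smul]
        exact zero_mem _
      · exact Submodule.smul_mem _ _ (theta_mem_contactLT h u)
    · by_cases h0 : k.2 l = 0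
      · rw [h0, Nat.cast_zero, zero_smul]
        exact zero_mem _
      · refine Submodule.smul_mem _ _ (theta_mem_contactLT ?_ _)
        have hle : Finsupp.single l 1 ≤ k.2 := by
          rw [Finsupp.single_le_iff]
          exact Nat.one_le_iff_ne_zero.2 h0
        have h1 := degree_cons (k.2 - Finsupp.single l 1) l
        rw [MultiIndex.cons, tsub_add_cancel_of_le hle] at h1
        change (k.2 - Finsupp.single l 1).degree < K
        omega

/-- Closedness gives `∑ P_l D_l φ = 0`, so `(K + n) φ` has order below `K`; as `n > 0`, the scalar
can be divided out and the order descends. -/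
theorem eq_zero_of_wedgeD_totalDerivContact_eq_zero (hn : 0 < n) (K : ℕ) :
    ∀ φ : S1 n m q 0, (∀ v, φ v ∈ contactLT n m q K) → wedgeD totalDerivContact 0 φ = 0 →
      φ = 0 := by
  induction K with
  | zero =>
    intro φ hφ _
    ext v
    simpa [contactLT_zero] using hφ v
  | succ K ih =>
    intro φ hφ hd
    refine ih φ (fun v => ?_) hd
    have h1 := contract_wedgeD_zero totalDerivContact lowerContact φ
    rw [hd] at h1
    have h2 := sum_lowerContact_sub_mem (hφ v)
    have h3 : (∑ l, lowerContact l ∘ₗ totalDerivContact l) (φ v) = 0 := by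
      rw [← LinearMap.compAlternatingMap_apply, ← h1, contract_apply]
      simp
    rw [h3, zero_sub, neg_mem_iff, Submodule.smul_mem_iff] at h2
    · exact h2
    · positivity

/-- With `M = ∑ P_l D_l`, the Cartan formula reads `Mφ = dψ + (r+1)φ`. The lower order form `Mφ -
(K+n)φ` is closed, hence exact by induction, and equals `-(K+n-r-1)φ` up to an exact form. The bound
`r + 1 < n` keeps this scalar nonzero even for `K = 0`. -/
theorem mem_range_wedgeD_totalDerivContact {r : ℕ} (hr : r + 1 < n) (K : ℕ) :
    ∀ φ : S1 n m q (r + 1), (∀ v, φ v ∈ contactLT n m q K) →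
      wedgeD totalDerivContact (r + 1) φ = 0 →
      φ ∈ LinearMap.range (wedgeD (n := n) (V := Contact n m q) totalDerivContact r) := by
  induction K with
  | zero =>
    intro φ hφ _
    have : φ = 0 := by
      ext v
      simpa [contactLT_zero] using hφ v
    rw [this]
    exact zero_mem _
  | succ K ih =>
    intro φ hφ hd
    have h1 := contract_wedgeD totalDerivContact lowerContact 1 lowerContact_totalDerivContact φ
    have h0 : contract lowerContact (r + 1) (0 : S1 n m q (r + 2)) = 0 := by
      ext v
      simp [contract_apply]
    rw [hd, h0, zero_add, one_mul] at h1
    set M := (∑ l, lowerContact l ∘ₗ totalDerivContact (n := n) (m := m) (q := q) l) with hM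
    set ψ := contract lowerContact r φ
    have hφ' : M.compAlternatingMap φ - ((K : ℝ) + n) • φ =
        wedgeD totalDerivContact r ψ - ((K : ℝ) + n - (r + 1)) • φ := by
      rw [h1, sub_smul _ ((r : ℝ) + 1)]
      abel
    have h2 := ih (M.compAlternatingMap φ - ((K : ℝ) + n) • φ)
      (fun v => sum_lowerContact_sub_mem (hφ v)) (by
        rw [hφ', map_sub, map_smul, hd, wedgeD_wedgeD _ totalDerivContact_comm]
        simp)
    rw [hφ'] at h2
    have h3 := (Submodule.sub_mem_iff_right _ (LinearMap.mem_range_self _ ψ)).1 h2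
    refine (Submodule.smul_mem_iff _ ?_).1 h3
    have : ((r + 1 : ℕ) : ℝ) < n := by exact_mod_cast hr
    push_cast at this
    have hK : (0 : ℝ) ≤ K := K.cast_nonneg
    linarith

theorem range_dH1 (r : ℕ) : LinearMap.range (dH1 n m q r) =
    LinearMap.range (wedgeD (n := n) (V := Contact n m q) totalDerivContact r) :=
  LinearMap.range_neg _

theorem dH1_eq_zero_iff {r : ℕ} {φ : S1 n m q r} :
    dH1 n m q r φ = 0 ↔ wedgeD totalDerivContact r φ = 0 := by
  rw [dH1, LinearMap.neg_apply, neg_eq_zero]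

theorem ker_dH1 {r : ℕ} (hr : r < n) :
    LinearMap.ker (dH1 n m q r) = boundary1 n m q r := by
  ext φ
  rw [LinearMap.mem_ker, dH1_eq_zero_iff]
  obtain ⟨K, hK⟩ := HForm.exists_forall_mem _ contactLT_mono exists_mem_contactLT φ
  cases r with
  | zero =>
    refine ⟨fun h => eq_zero_of_wedgeD_totalDerivContact_eq_zero hr K φ hK h, fun h => ?_⟩
    rw [show φ = 0 from h, map_zero]
  | succ r =>
    rw [boundary1, range_dH1]
    refine ⟨mem_range_wedgeD_totalDerivContact hr K φ hK, ?_⟩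
    rintro ⟨ψ, rfl⟩
    exact wedgeD_wedgeD _ totalDerivContact_comm ψ

section TopForms

variable {V : Type} [AddCommGroup V] [Module ℝ V]

/-- On forms of top degree `D_λ φ = d (∂_λ ⌋ φ)`. -/
theorem comp_mem_range_wedgeD (D : Fin (n + 1) → V →ₗ[ℝ] V) (l : Fin (n + 1))
    (φ : HForm (n + 1) (n + 1) V) :
    (D l).compAlternatingMap φ ∈ LinearMap.range (wedgeD D n) := by
  -- This `P` contracts with `∂_l` alone. It commutes with every `D`, so `c = 0`, and `dφ` vanishes
  -- above the top degree.
  let P : Fin (n + 1) → V →ₗ[ℝ] V := fun k => if k = l then LinearMap.id else 0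
  have h := contract_wedgeD D P 0 (fun a b x => by by_cases ha : a = l <;> simp [P, ha]) φ
  rw [show wedgeD D (n + 1) φ = 0 from Subsingleton.elim _ _] at h
  have h0 : contract P (n + 1) (0 : HForm (n + 1) (n + 1 + 1) V) = 0 := by
    ext v
    simp [contract_apply]
  have h2 : ∑ k, P k ∘ₗ D k = D l := by
    rw [Finset.sum_eq_single l]
    · simp [P]
    · intro b _ hb
      simp [P, hb]
    · simp
  rw [h0, h2, zero_add, zero_mul, zero_smul, sub_zero] at h
  exact ⟨_, h⟩

/-- The form `c dx^1 ∧ ⋯ ∧ dx^n`. -/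
def volumeForm (n : ℕ) : V →ₗ[ℝ] HForm n n V where
  toFun c := (LinearMap.toSpanSingleton ℝ V c).compAlternatingMap (Pi.basisFun ℝ (Fin n)).det
  map_add' c d := by
    ext v
    simp
  map_smul' a c := by
    ext v
    exact smul_comm _ _ _

theorem volumeForm_apply (c : V) (v : Fin n → Fin n → ℝ) :
    volumeForm n c v = (Pi.basisFun ℝ (Fin n)).det v • c := rfl

theorem exists_volumeForm (φ : HForm n n V) : ∃ c, φ = volumeForm n c := by
  refine ⟨φ (Pi.basisFun ℝ (Fin n)), ?_⟩
  refine Module.Basis.ext_alternating (Pi.basisFun ℝ (Fin n)) fun v hv => ?_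
  obtain ⟨σ, rfl⟩ : ∃ σ : Equiv.Perm (Fin n), v = σ :=
    ⟨Equiv.ofBijective v (Finite.injective_iff_bijective.1 hv), rfl⟩
  have h1 := φ.map_perm (Pi.basisFun ℝ (Fin n)) σ
  have h2 := (Pi.basisFun ℝ (Fin n)).det.map_perm (Pi.basisFun ℝ (Fin n)) σ
  rw [volumeForm_apply]
  change φ (⇑(Pi.basisFun ℝ (Fin n)) ∘ σ) =
    (Pi.basisFun ℝ (Fin n)).det (⇑(Pi.basisFun ℝ (Fin n)) ∘ σ) • _
  rw [h1, h2, Module.Basis.det_self]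
  rcases Int.units_eq_one_or (Equiv.Perm.sign σ) with h | h <;> simp [h]

theorem comp_volumeForm {W : Type} [AddCommGroup W] [Module ℝ W] (T : V →ₗ[ℝ] W) (c : V) :
    T.compAlternatingMap (volumeForm n c) = volumeForm n (T c) := by
  ext v
  simp [volumeForm_apply]

end TopForms

/-- Integration by parts, by induction on `|Λ|`: in `θ_{l+Λ} u = D_l(θ_Λ u) - θ_Λ d_l u` the first
term is exact in top degree and killed by `ϱ`. -/
theorem volumeForm_sub_rhoContact_mem (x : Contact (n + 1) m q) :
    volumeForm (n + 1) (x - rhoContact (n + 1) m q x) ∈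
      LinearMap.range (wedgeD (V := Contact (n + 1) m q) totalDerivContact n) := by
  set R := LinearMap.range (wedgeD (n := n + 1) (V := Contact (n + 1) m q) totalDerivContact n)
  have hD : ∀ l (x : Contact (n + 1) m q), volumeForm (n + 1) (totalDerivContact l x) ∈ R := by
    intro l x
    rw [← comp_volumeForm]
    exact comp_mem_range_wedgeD _ l _
  have htheta : ∀ (d : ℕ) (k : FibreCoord (n + 1) m q) u, k.2.degree = d →
      volumeForm (n + 1) (Contact.theta k u - rhoContact (n + 1) m q (Contact.theta k u)) ∈ R := by
    intro d
    induction d with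
    | zero =>
      rintro ⟨A, L⟩ u hk
      obtain rfl : L = 0 := (Finsupp.degree_eq_zero_iff L).1 hk
      rw [rhoContact_theta, iterTotalDeriv_zero]
      simp
    | succ d ih =>
      rintro ⟨A, L⟩ u hk
      obtain ⟨l, hl⟩ : ∃ l, L l ≠ 0 := by
        by_contra! h
        obtain rfl : L = 0 := Finsupp.ext h
        simp at hk
      have hle : Finsupp.single l 1 ≤ L := by
        rw [Finsupp.single_le_iff]
        exact Nat.one_le_iff_ne_zero.2 hl
      obtain ⟨L, rfl⟩ : ∃ L', L = MultiIndex.cons l L' :=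
        ⟨L - Finsupp.single l 1, (tsub_add_cancel_of_le hle).symm⟩
      have h1 : Contact.theta (A, L.cons l) u = totalDerivContact l (Contact.theta (A, L) u) -
          Contact.theta (A, L) (totalDeriv l u) := by
        rw [totalDerivContact_theta, add_sub_cancel_right]
      have h2 := ih (A, L) (totalDeriv l u) (by rw [degree_cons] at hk; simpa using hk)
      rw [h1, map_sub (rhoContact _ _ _), rhoContact_totalDerivContact, zero_sub, sub_neg_eq_add,
        sub_add, map_sub]
      exact sub_mem (hD _ _) h2
  induction x using Contact.induction with
  | zero => simp
  | add x y hx hy =>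
    rw [map_add (rhoContact _ _ _), add_sub_add_comm, map_add]
    exact add_mem hx hy
  | theta k u => exact htheta _ k u rfl

theorem rho_eq_zero_iff {φ : S1 n m q n} : rhoE1 n m q φ = 0 ↔ rho n m q φ = 0 := by
  rw [rhoE1, ← LinearMap.mem_ker, LinearMap.ker_rangeRestrict, LinearMap.mem_ker]

theorem ker_rhoE1 : LinearMap.ker (rhoE1 n m q) = boundary1 n m q n := by
  ext φ
  rw [LinearMap.mem_ker, rho_eq_zero_iff]
  cases n with
  | zero =>
    -- Over a point the only multi-index is `0`, so `ϱ` is the identity and the preceding boundary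
    -- is `⊥`.
    have h : rhoContact 0 m q = LinearMap.id := by
      refine Contact.hom_ext fun k u => ?_
      obtain ⟨A, L⟩ := k
      obtain rfl : L = 0 := Subsingleton.elim _ _
      rw [rhoContact_theta, iterTotalDeriv_zero]
      simp
    refine ⟨fun h0 => ?_, fun h0 => ?_⟩
    · rw [rho, h] at h0
      exact h0
    · rw [show φ = 0 from h0, map_zero]
  | succ n =>
    rw [boundary1, range_dH1]
    constructor
    · intro h0
      obtain ⟨c, rfl⟩ := exists_volumeForm φ
      have h1 := volumeForm_sub_rhoContact_mem c
      rw [map_sub, ← comp_volumeForm (rhoContact (n + 1) m q)] at h1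
      rw [rho, LinearMap.compAlternatingMapₗ_apply] at h0
      rwa [h0, sub_zero] at h1
    · rintro ⟨ψ, rfl⟩
      exact comp_wedgeD_eq_zero _ _ rhoContact_totalDerivContact ψ

end GradedJet

/-! ### From the one-contact complex to the short variational complex -/

namespace GradedJet

variable {n m q : ℕ}

/-! ### The homotopy in the even fibre coordinates -/

/-- The coordinates `y^i_Λ`. -/
def fibreSet (n m : ℕ) : Set (EvenCoord n m) := Set.range Sum.inr

/-- The coordinates `x^λ`. -/
def baseSet (n m : ℕ) : Set (EvenCoord n m) := Set.range Sum.inl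

/-- The operator `average` on graded functions. -/
def gaverage (B : Set (EvenCoord n m)) (k : ℕ) : GradedFun n m q →ₗ[ℝ] GradedFun n m q :=
  (average B k).rTensor (Grassmann n q)

/-- The operator `restrict` on graded functions. -/
def grestrict (B : Set (EvenCoord n m)) : GradedFun n m q →ₗ[ℝ] GradedFun n m q :=
  (restrict B).rTensor (Grassmann n q)

theorem gaverage_basePartial (k : ℕ) (l : Fin n) (u : GradedFun n m q) :
    gaverage (fibreSet n m) k (basePartial l u) = basePartial l (gaverage (fibreSet n m) k u) := by
  induction u using TensorProduct.induction_on with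
  | zero => simp only [map_zero]
  | add x y hx hy => simp only [map_add, hx, hy]
  | tmul f x => simp [gaverage, basePartial, evenPartial_average, fibreSet]

/-- Multiplication by `y` and differentiation in `y` shift the weight in compensating ways; the odd
variables are not dilated at all. -/
theorem gaverage_fibreCoord_mul (A : Fin m ⊕ Fin q) (L L' : MultiIndex n)
    (u : GradedFun n m q) :
    gaverage (fibreSet n m) 0 (fibreCoord (A, L') * fibrePartial (A, L) u) =
      fibreCoord (A, L') * fibrePartial (A, L) (gaverage (fibreSet n m) 0 u) := by
  induction u using TensorProduct.induction_on with
  | zero => simp only [map_zero, mul_zero]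
  | add x y hx hy => simp only [map_add, mul_add, hx, hy]
  | tmul f x =>
    rcases A with i | a
    · simp [gaverage, fibrePartial, fibreCoord, evenPartial_average, average_evenCoord_mul,
        fibreSet]
    · simp [gaverage, fibrePartial, fibreCoord]

theorem gaverage_totalDeriv (l : Fin n) (u : GradedFun n m q) :
    gaverage (fibreSet n m) 0 (totalDeriv l u) = totalDeriv l (gaverage (fibreSet n m) 0 u) := by
  classical
  rw [totalDeriv_eq_sum l (Finset.subset_union_left
      (s₂ := fibreSupport (gaverage (fibreSet n m) 0 u))),
    totalDeriv_eq_sum l (Finset.subset_union_right (s₁ := fibreSupport u)), map_add, map_sum,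
    gaverage_basePartial]
  exact congrArg _ (Finset.sum_congr rfl fun k _ => gaverage_fibreCoord_mul k.1 k.2 _ u)

/-- The operator `θ^i_Λ f ↦ y^i_Λ ∫₀¹ f(x, t y) dt`, `θ^a_Λ f ↦ 0`. -/
def evenContract : Contact n m q →ₗ[ℝ] GradedFun n m q :=
  Contact.lift fun k => match k with
    | (Sum.inl i, L) => LinearMap.mulLeft ℝ (fibreCoord (Sum.inl i, L)) ∘ₗ
        gaverage (fibreSet n m) 0
    | (Sum.inr _, _) => 0

theorem evenContract_inl (i : Fin m) (L : MultiIndex n) (u : GradedFun n m q) :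
    evenContract (Contact.theta (Sum.inl i, L) u) =
      fibreCoord (Sum.inl i, L) * gaverage (fibreSet n m) 0 u := by
  rw [evenContract, Contact.lift_theta]
  rfl

theorem evenContract_inr (a : Fin q) (L : MultiIndex n) (u : GradedFun n m q) :
    evenContract (Contact.theta (Sum.inr a, L) u) = 0 := by
  rw [evenContract, Contact.lift_theta]
  rfl

/-- The rule `d_l y_Λ = y_{l+Λ}` mirrors `D_l θ_Λ = θ_{l+Λ}`, and the average commutes with `d_l`.
-/
theorem evenContract_totalDerivContact (l : Fin n) (x : Contact n m q) :
    evenContract (totalDerivContact l x) = totalDeriv l (evenContract x) := by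
  induction x using Contact.induction with
  | zero => simp only [map_zero]
  | add x y hx hy => simp only [map_add, hx, hy]
  | theta k u =>
    rcases k with ⟨i | a, L⟩
    · simp only [totalDerivContact_theta, map_add, evenContract_inl, totalDeriv_fibreCoord_mul,
        gaverage_totalDeriv]
    · simp only [totalDerivContact_theta, map_add, evenContract_inr, map_zero, add_zero]

theorem evenContract_vertFun (u : GradedFun n m q) :
    evenContract (vertFun u) = u - grestrict (fibreSet n m) u := by
  classical
  induction u using TensorProduct.induction_on with
  | zero => simp only [map_zero, sub_zero]
  | add x y hx hy =>
    simp only [map_add, hx, hy]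
    abel
  | tmul f x =>
    set A : Finset (Fin m × MultiIndex n) :=
      ((evenPartial_finite f).preimage Sum.inr_injective.injOn).toFinset with hA
    have hmem : ∀ z, z ∈ A ↔ evenPartial (Sum.inr z) f ≠ 0 := by
      intro z
      simp [hA]
    let e : Fin m × MultiIndex n → FibreCoord n m q := fun z => (Sum.inl z.1, z.2)
    have he : Function.Injective e := by
      rintro ⟨i, L⟩ ⟨i', L'⟩ h
      simpa [e] using h
    rw [vertFun_eq_sum (Finset.subset_union_left (s₂ := A.image e)), map_sum,
      ← Finset.sum_subset (Finset.subset_union_right), Finset.sum_image fun _ _ _ _ h => he h]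
    · have h1 := sum_evenCoord_mul_average (fibreSet n m) (A.map ⟨Sum.inr, Sum.inr_injective⟩)
        (by simp [fibreSet]) f (by
          rintro _ ⟨z, rfl⟩ hz
          simpa using (hmem z).2 hz)
      rw [Finset.sum_map] at h1
      have h2 : ∀ z ∈ A, evenContract (Contact.theta (e z) (fibrePartial (e z) (f ⊗ₜ[ℝ] x))) =
          (evenCoord (Sum.inr z) * average (fibreSet n m) 0 (evenPartial (Sum.inr z) f)) ⊗ₜ[ℝ] x
          := by
        intro z _
        simp [e, evenContract_inl, fibreCoord, fibrePartial, gaverage]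
      rw [Finset.sum_congr rfl h2, ← TensorProduct.sum_tmul]
      change (∑ z ∈ A, evenCoord (Sum.inr z) *
        average (fibreSet n m) 0 (evenPartial (Sum.inr z) f) = _) at h1
      rw [h1, TensorProduct.sub_tmul]
      rfl
    · rintro ⟨i | a, L⟩ _ hk
      · have h3 : evenPartial (Sum.inr (i, L)) f = 0 := by
          by_contra h
          exact hk (Finset.mem_image.2 ⟨(i, L), (hmem _).2 h, rfl⟩)
        simp [fibrePartial, h3]
      · exact evenContract_inr _ _ _

theorem fibrePartial_grestrict (i : Fin m) (L : MultiIndex n) (u : GradedFun n m q) :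
    fibrePartial (Sum.inl i, L) (grestrict (fibreSet n m) u) = 0 := by
  induction u using TensorProduct.induction_on with
  | zero => simp only [map_zero]
  | add x y hx hy => simp only [map_add, hx, hy, add_zero]
  | tmul f x =>
    simp [grestrict, fibrePartial, evenPartial_restrict (fibreSet n m) ⟨(i, L), rfl⟩]

/-! ### The homotopy in the odd fibre coordinates -/

/-- The indicator of the odd coordinates. -/
def oddIndicator : FibreCoord n m q → ℝ
  | (Sum.inl _, _) => 0
  | (Sum.inr _, _) => 1

/-- The operator `θ^i_Λ f ↦ 0`, `θ^a_Λ f ↦ c^a_Λ f`. -/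
def oddContract : Contact n m q →ₗ[ℝ] GradedFun n m q :=
  Contact.lift fun k => oddIndicator k • LinearMap.mulLeft ℝ (fibreCoord k)

theorem oddContract_theta (k : FibreCoord n m q) (u : GradedFun n m q) :
    oddContract (Contact.theta k u) = oddIndicator k • (fibreCoord k * u) := by
  rw [oddContract, Contact.lift_theta]
  rfl

theorem oddContract_totalDerivContact (l : Fin n) (x : Contact n m q) :
    oddContract (totalDerivContact l x) = totalDeriv l (oddContract x) := by
  induction x using Contact.induction with
  | zero => simp only [map_zero]
  | add x y hx hy => simp only [map_add, hx, hy]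
  | theta k u =>
    have h : oddIndicator (k.1, k.2.cons l) = oddIndicator k := by
      rcases k with ⟨_ | _, _⟩ <;> rfl
    simp only [totalDerivContact_theta, map_add, oddContract_theta, h, map_smul,
      totalDeriv_fibreCoord_mul, smul_add]

/-- The operator counting the odd variables. -/
def oddNumber : GradedFun n m q →ₗ[ℝ] GradedFun n m q := oddContract ∘ₗ vertFun

theorem oddNumber_eq_sum {u : GradedFun n m q} {S : Finset (FibreCoord n m q)}
    (hS : fibreSupport u ⊆ S) :
    oddNumber u = ∑ k ∈ S, oddIndicator k • (fibreCoord k * fibrePartial k u) := by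
  rw [oddNumber, LinearMap.comp_apply, oddContract, Contact.lift_eq_sum _ hS]
  rfl

theorem oddNumber_totalDeriv (l : Fin n) (u : GradedFun n m q) :
    oddNumber (totalDeriv l u) = totalDeriv l (oddNumber u) := by
  simp only [oddNumber, LinearMap.comp_apply, vertFun_totalDeriv, oddContract_totalDerivContact]

theorem fibrePartial_oddNumber (i : Fin m) (L : MultiIndex n) (u : GradedFun n m q) :
    fibrePartial (Sum.inl i, L) (oddNumber u) = oddNumber (fibrePartial (Sum.inl i, L) u) := by
  classical
  have hsign : ∀ k : FibreCoord n m q, gsign (Sum.inl i, L) k = 1 := by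
    rintro ⟨_ | _, _⟩ <;> rfl
  rw [oddNumber_eq_sum (S := fibreSupport u) subset_rfl,
    oddNumber_eq_sum (S := fibreSupport u), map_sum]
  · refine Finset.sum_congr rfl fun k _ => ?_
    rw [map_smul, fibrePartial_mul, fibrePartial_comm _ k, hsign, one_smul, one_smul, smul_add]
    rcases k with ⟨i' | a, L'⟩ <;> simp [oddIndicator]
  · intro k hk
    rw [mem_fibreSupport, fibrePartial_comm] at hk
    rw [mem_fibreSupport]
    exact fun h => hk (by rw [h, map_zero, smul_zero])

theorem oddNumber_fibreCoord_mul (a : Fin q) (L : MultiIndex n) (u : GradedFun n m q) :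
    oddNumber (fibreCoord (Sum.inr a, L) * u) =
      fibreCoord (Sum.inr a, L) * u + fibreCoord (Sum.inr a, L) * oddNumber u := by
  classical
  set j : FibreCoord n m q := (Sum.inr a, L) with hj
  set S := fibreSupport (fibreCoord j * u) ∪ (fibreSupport u ∪ {j}) with hS
  rw [oddNumber_eq_sum (S := S) Finset.subset_union_left,
    oddNumber_eq_sum (u := u) (S := S)
      (Finset.subset_union_left.trans Finset.subset_union_right), Finset.mul_sum]
  simp only [fibrePartial_mul, mul_add, smul_add, Finset.sum_add_distrib, mul_ite, mul_zero,
    smul_ite, smul_zero]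
  rw [Finset.sum_ite_eq', if_pos (by simp [hS])]
  congr 1
  · simp [hj, oddIndicator]
  · refine Finset.sum_congr rfl fun k _ => ?_
    rw [mul_smul_comm, mul_smul_comm, fibreCoord_comm k, smul_smul (gsign k j), gsign_mul_self,
      one_smul]

theorem oddNumber_ι_mul (v : OddCoord n q →₀ ℝ) (u : GradedFun n m q) :
    oddNumber ((1 ⊗ₜ[ℝ] ExteriorAlgebra.ι ℝ v) * u) =
      (1 ⊗ₜ[ℝ] ExteriorAlgebra.ι ℝ v) * u + (1 ⊗ₜ[ℝ] ExteriorAlgebra.ι ℝ v) * oddNumber u := by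
  induction v using Finsupp.induction_linear with
  | zero => simp
  | add v w hv hw =>
    simp only [map_add, TensorProduct.tmul_add, add_mul, hv, hw]
    abel
  | single z c =>
    have h : (1 : SmoothFun n m) ⊗ₜ[ℝ] ExteriorAlgebra.ι ℝ (Finsupp.single z c) =
        c • fibreCoord (Sum.inr z.1, z.2) := by
      rw [fibreCoord, ← TensorProduct.tmul_smul, ← map_smul, Finsupp.smul_single_one]
    rw [h]
    simp only [smul_mul_assoc, map_smul, oddNumber_fibreCoord_mul, smul_add]

/-- The inclusion of the smooth functions into the graded functions. -/
def body : SmoothFun n m →ₗ[ℝ] GradedFun n m q := (TensorProduct.mk ℝ _ _).flip 1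

theorem body_apply (f : SmoothFun n m) : (body f : GradedFun n m q) = f ⊗ₜ[ℝ] 1 := rfl

theorem body_injective : Function.Injective (body : SmoothFun n m →ₗ[ℝ] GradedFun n m q) := by
  refine Function.LeftInverse.injective (g := fun u => TensorProduct.rid ℝ (SmoothFun n m)
    ((ExteriorAlgebra.algebraMapInv (M := OddCoord n q →₀ ℝ)).toLinearMap.lTensor
      (SmoothFun n m) u)) fun f => ?_
  simp [body_apply]

theorem fibrePartial_inr_body (a : Fin q) (L : MultiIndex n) (f : SmoothFun n m) :
    fibrePartial (Sum.inr a, L) (body f : GradedFun n m q) = 0 := by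
  simp [body_apply, fibrePartial, oddPartial_one]

theorem oddNumber_body (f : SmoothFun n m) : oddNumber (body f : GradedFun n m q) = 0 := by
  rw [oddNumber_eq_sum subset_rfl]
  refine Finset.sum_eq_zero fun k _ => ?_
  rcases k with ⟨i | a, L⟩
  · simp [oddIndicator]
  · rw [fibrePartial_inr_body, mul_zero, smul_zero]

/-- The operator `(N - 1) ⋯ (N - K)`, where `N` counts the odd variables. -/
def oddProduct : ℕ → GradedFun n m q →ₗ[ℝ] GradedFun n m q
  | 0 => LinearMap.id
  | K + 1 => (oddNumber - ((K : ℝ) + 1) • LinearMap.id) ∘ₗ oddProduct K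

theorem oddProduct_succ (K : ℕ) (u : GradedFun n m q) :
    oddProduct (K + 1) u = oddNumber (oddProduct K u) - ((K : ℝ) + 1) • oddProduct K u := rfl

theorem oddProduct_totalDeriv (K : ℕ) (l : Fin n) (u : GradedFun n m q) :
    oddProduct K (totalDeriv l u) = totalDeriv l (oddProduct K u) := by
  induction K with
  | zero => rfl
  | succ K ih => simp only [oddProduct_succ, ih, oddNumber_totalDeriv, map_sub, map_smul]

theorem fibrePartial_oddProduct (K : ℕ) (i : Fin m) (L : MultiIndex n) (u : GradedFun n m q) :
    fibrePartial (Sum.inl i, L) (oddProduct K u) = oddProduct K (fibrePartial (Sum.inl i, L) u) := by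
  induction K with
  | zero => rfl
  | succ K ih => simp only [oddProduct_succ, ← ih, fibrePartial_oddNumber, map_sub, map_smul]

/-- Since `N c = c (N + 1)`, moving an odd variable to the left shifts every factor: `(N-1)⋯(N-K-1)
c = c N (N-1)⋯(N-K)`. -/
theorem oddProduct_ι_mul (K : ℕ) (v : OddCoord n q →₀ ℝ) (u : GradedFun n m q) :
    oddProduct (K + 1) ((1 ⊗ₜ[ℝ] ExteriorAlgebra.ι ℝ v) * u) =
      (1 ⊗ₜ[ℝ] ExteriorAlgebra.ι ℝ v) * oddNumber (oddProduct K u) := by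
  induction K with
  | zero =>
    rw [oddProduct_succ]
    simp [oddProduct, oddNumber_ι_mul]
  | succ K ih =>
    rw [oddProduct_succ, ih, oddNumber_ι_mul, oddProduct_succ, map_sub, map_smul, mul_sub,
      mul_smul_comm]
    push_cast
    module

/-- `N` vanishes on the body, so further factors act there by scalars. -/
theorem oddProduct_mem_mono :
    Monotone fun K => (LinearMap.range (body (n := n) (m := m) (q := q))).comap (oddProduct K) := by
  refine monotone_nat_of_le_succ fun K u hu => ?_
  obtain ⟨f, hf⟩ := hu
  refine ⟨-((K : ℝ) + 1) • f, ?_⟩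
  rw [oddProduct_succ, ← hf, oddNumber_body, zero_sub, map_smul, neg_smul]

/-- Each additional generator costs one factor: once the product on `x` lies in the body, `N` kills
it, and the next product kills `c x`. -/
theorem exists_oddProduct_mem (u : GradedFun n m q) :
    ∃ K, u ∈ (LinearMap.range (body (n := n) (m := m) (q := q))).comap (oddProduct K) := by
  have hadd : ∀ x y : GradedFun n m q,
      (∃ K, x ∈ (LinearMap.range (body (n := n) (m := m) (q := q))).comap (oddProduct K)) →
      (∃ K, y ∈ (LinearMap.range (body (n := n) (m := m) (q := q))).comap (oddProduct K)) →
      ∃ K, x + y ∈ (LinearMap.range (body (n := n) (m := m) (q := q))).comap (oddProduct K) := by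
    rintro x y ⟨K, hK⟩ ⟨L, hL⟩
    exact ⟨max K L, add_mem (oddProduct_mem_mono (le_max_left _ _) hK)
      (oddProduct_mem_mono (le_max_right _ _) hL)⟩
  induction u using TensorProduct.induction_on with
  | zero => exact ⟨0, zero_mem _⟩
  | add x y hx hy => exact hadd x y hx hy
  | tmul f x =>
    induction x using CliffordAlgebra.left_induction with
    | algebraMap c =>
      refine ⟨0, c • f, ?_⟩
      rw [body_apply, TensorProduct.smul_tmul, Algebra.algebraMap_eq_smul_one]
      rfl
    | add x y hx hy =>
      rw [TensorProduct.tmul_add]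
      exact hadd _ _ hx hy
    | ι_mul x v hx =>
      obtain ⟨K, g, hg⟩ := hx
      refine ⟨K + 1, ?_⟩
      have h := oddProduct_ι_mul K v (f ⊗ₜ[ℝ] x)
      rw [Algebra.TensorProduct.tmul_mul_tmul, one_mul, ← hg, oddNumber_body, mul_zero] at h
      rw [Submodule.mem_comap]
      change oddProduct (K + 1) (f ⊗ₜ[ℝ] (ExteriorAlgebra.ι ℝ v * x)) ∈ _
      rw [h]
      exact zero_mem _

/-- Modulo an `N`-stable subspace containing `Nφ`, every factor `N - j` multiplies `φ` by `-j`, so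
`c` is `(-1)^K K!`. -/
theorem exists_oddProduct_sub_mem {r : ℕ} (B : Submodule ℝ (S0 n m q r))
    (hB : ∀ φ ∈ B, oddNumber.compAlternatingMap φ ∈ B) {φ : S0 n m q r}
    (hφ : oddNumber.compAlternatingMap φ ∈ B) (K : ℕ) :
    ∃ c : ℝ, c ≠ 0 ∧ (oddProduct K).compAlternatingMap φ - c • φ ∈ B := by
  induction K with
  | zero =>
    refine ⟨1, one_ne_zero, ?_⟩
    rw [one_smul]
    exact (sub_self φ).symm ▸ zero_mem B
  | succ K ih =>
    obtain ⟨c, hc, h⟩ := ih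
    refine ⟨-((K : ℝ) + 1) * c, mul_ne_zero (neg_ne_zero.2 (by positivity)) hc, ?_⟩
    have h1 := add_mem (sub_mem (hB _ h) (B.smul_mem ((K : ℝ) + 1) h)) (B.smul_mem c hφ)
    convert h1 using 1
    ext v
    simp only [AlternatingMap.add_apply, AlternatingMap.sub_apply, AlternatingMap.smul_apply,
      LinearMap.compAlternatingMap_apply, oddProduct_succ, map_sub, map_smul]
    module

/-! ### The Poincaré lemma on the base -/

theorem basePartial_gaverage_base (k : ℕ) (l : Fin n) (u : GradedFun n m q) :
    gaverage (baseSet n m) (k + 1) (basePartial l u) =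
      basePartial l (gaverage (baseSet n m) k u) := by
  induction u using TensorProduct.induction_on with
  | zero => simp only [map_zero]
  | add x y hx hy => simp only [map_add, hx, hy]
  | tmul f x => simp [gaverage, basePartial, evenPartial_average, baseSet]

theorem fibrePartial_gaverage_base (r : ℕ) (k : FibreCoord n m q) (u : GradedFun n m q) :
    fibrePartial k (gaverage (baseSet n m) r u) = gaverage (baseSet n m) r (fibrePartial k u) := by
  induction u using TensorProduct.induction_on with
  | zero => simp only [map_zero]
  | add x y hx hy => simp only [map_add, hx, hy]
  | tmul f x =>
    rcases k with ⟨i | a, L⟩ <;> simp [gaverage, fibrePartial, evenPartial_average, baseSet]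

/-- Multiplication by `x^λ`. -/
def mulBase (l : Fin n) : GradedFun n m q →ₗ[ℝ] GradedFun n m q :=
  (LinearMap.mulLeft ℝ (evenCoord (Sum.inl l))).rTensor (Grassmann n q)

theorem fibrePartial_mulBase (l : Fin n) (k : FibreCoord n m q) (u : GradedFun n m q) :
    fibrePartial k (mulBase l u) = mulBase l (fibrePartial k u) := by
  induction u using TensorProduct.induction_on with
  | zero => simp only [map_zero]
  | add x y hx hy => simp only [map_add, hx, hy]
  | tmul f x =>
    rcases k with ⟨i | a, L⟩ <;>
      simp [mulBase, fibrePartial, evenPartial_mul, evenPartial_evenCoord]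

theorem mulBase_basePartial (l k : Fin n) (u : GradedFun n m q) :
    mulBase l (basePartial k u) =
      basePartial k (mulBase l u) + if l = k then (-1 : ℝ) • u else 0 := by
  induction u using TensorProduct.induction_on with
  | zero => simp
  | add x y hx hy =>
    simp only [map_add, hx, hy, smul_add]
    split_ifs <;> abel
  | tmul f x =>
    by_cases h : l = k
    · subst h
      simp [mulBase, basePartial, evenPartial_mul, evenPartial_evenCoord, TensorProduct.add_tmul]
    · simp [mulBase, basePartial, evenPartial_mul, evenPartial_evenCoord, h, Ne.symm h]

theorem sum_mulBase_basePartial_gaverage (k : ℕ) (u : GradedFun n m q) :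
    (∑ l, mulBase l ∘ₗ basePartial l) (gaverage (baseSet n m) k u) =
      u - ((k : ℝ) + 1) • gaverage (baseSet n m) k u := by
  simp only [LinearMap.sum_apply, LinearMap.comp_apply, ← basePartial_gaverage_base]
  induction u using TensorProduct.induction_on with
  | zero => simp
  | add x y hx hy =>
    simp only [map_add, Finset.sum_add_distrib, hx, hy, smul_add]
    abel
  | tmul f x =>
    have h := sum_evenCoord_mul_average_succ (baseSet n m)
      (Finset.univ.map ⟨Sum.inl, Sum.inl_injective⟩) (by simp [baseSet]) f
      (by rintro _ ⟨l, rfl⟩ _; simp) k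
    rw [Finset.sum_map] at h
    simp only [mulBase, gaverage, basePartial, LinearMap.rTensor_tmul, LinearMap.mulLeft_apply]
    rw [← TensorProduct.sum_tmul, TensorProduct.smul_tmul', ← TensorProduct.sub_tmul, ← h]
    rfl

/-- Coefficients with no vertical derivative see `d_H` as the de Rham differential on `ℝ^n`; the
primitive is the contraction of the averaged form with the Euler field. -/
theorem mem_range_of_vertFun_eq_zero {r : ℕ} (φ : S0 n m q (r + 1))
    (hv : ∀ v, vertFun (φ v) = 0) (hd : dH0 n m q (r + 1) φ = 0) :
    φ ∈ LinearMap.range (dH0 n m q r) := by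
  rw [dH0, wedgeD_congr _ basePartial φ fun l v => totalDeriv_of_vertFun_eq_zero l (hv v)] at hd
  -- For `(r+1)`-forms the weight must be `r`: Euler's identity yields `φ - (r+1)χ`, and the
  -- commutator term restores `(r+1)χ`.
  set χ := (gaverage (baseSet n m) r).compAlternatingMap φ with hχ
  have hdχ : wedgeD basePartial (r + 1) χ = 0 := by
    rw [hχ, ← wedgeD_comp (T' := gaverage (baseSet n m) (r + 1))
      (basePartial_gaverage_base r), hd]
    ext v
    simp
  have h := contract_wedgeD basePartial mulBase (-1) mulBase_basePartial χ
  have h0 : contract mulBase (r + 1) (0 : S0 n m q (r + 2)) = 0 := by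
    ext v
    simp [contract_apply]
  rw [hdχ, h0, zero_add] at h
  refine ⟨contract mulBase r χ, ?_⟩
  rw [dH0, wedgeD_congr _ basePartial]
  · rw [h]
    ext v
    simp only [AlternatingMap.sub_apply, AlternatingMap.smul_apply,
      LinearMap.compAlternatingMap_apply, hχ, sum_mulBase_basePartial_gaverage]
    module
  · intro l v
    refine totalDeriv_of_vertFun_eq_zero l (vertFun_eq_zero_iff.2 fun k => ?_)
    rw [contract_apply, map_sum]
    refine Finset.sum_eq_zero fun a _ => ?_
    rw [fibrePartial_mulBase, hχ, LinearMap.compAlternatingMap_apply, fibrePartial_gaverage_base,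
      vertFun_eq_zero_iff.1 (hv _), map_zero, map_zero]

theorem exists_constant_of_vertFun_eq_zero (u : GradedFun n m q) (hv : vertFun u = 0)
    (hd : ∀ l, basePartial l u = 0) : ∃ c : ℝ, u = algebraMap ℝ _ c := by
  obtain ⟨f, rfl⟩ : ∃ f : SmoothFun n m, u = body f := by
    obtain ⟨K, hK⟩ := exists_oddProduct_mem u
    have hN : oddNumber u = 0 := by rw [oddNumber, LinearMap.comp_apply, hv, map_zero]
    -- As `Nu = 0`, the product acts on `u` by a nonzero scalar, so `u` itself lies in the body.
    have key : ∀ K : ℕ, ∃ c : ℝ, c ≠ 0 ∧ oddProduct K u = c • u := by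
      intro K
      induction K with
      | zero => exact ⟨1, one_ne_zero, (one_smul _ _).symm⟩
      | succ K ih =>
        obtain ⟨c, hc, h⟩ := ih
        refine ⟨-((K : ℝ) + 1) * c, mul_ne_zero (neg_ne_zero.2 (by positivity)) hc, ?_⟩
        rw [oddProduct_succ, h, map_smul, hN]
        module
    obtain ⟨c, hc, h⟩ := key K
    rw [Submodule.mem_comap, h, Submodule.smul_mem_iff _ hc] at hK
    obtain ⟨f, hf⟩ := hK
    exact ⟨f, hf.symm⟩
  have hz : ∀ z, evenPartial z f = 0 := by
    intro z
    refine body_injective (q := q) ?_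
    rw [map_zero]
    rcases z with l | ⟨i, L⟩
    · exact hd l
    · exact vertFun_eq_zero_iff.1 hv (Sum.inl i, L)
  -- All partial derivatives vanish, so the radial formula with empty `S` equates `f` with its value
  -- at the origin.
  have h := sum_evenCoord_mul_average Set.univ ∅ (by simp) f (fun z _ hz' => absurd (hz z) hz')
  rw [Finset.sum_empty] at h
  refine ⟨f.1 0, ?_⟩
  have hf : f = f.1 0 • (1 : SmoothFun n m) := by
    refine (sub_eq_zero.1 h.symm).trans (SmoothFun.ext fun p => ?_)
    change f.1 (dilate Set.univ 0 p) = f.1 0 * 1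
    rw [mul_one, show dilate Set.univ 0 p = 0 from funext fun z => by simp [dilate]]
  rw [Algebra.algebraMap_eq_smul_one, Algebra.TensorProduct.one_def, ← body_apply, ← map_smul]
  exact congrArg body hf

/-! ### Exactness of the short variational complex -/

theorem vertFun_dH0 {r : ℕ} (φ : S0 n m q r) :
    dV0 n m q (r + 1) (dH0 n m q r φ) = -dH1 n m q r (dV0 n m q r φ) := by
  rw [dH1, LinearMap.neg_apply, neg_neg]
  exact wedgeD_comp vertFun_totalDeriv φ

theorem comp_mem_range_dH0 {r : ℕ} (T : Contact n m q →ₗ[ℝ] GradedFun n m q)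
    (hT : ∀ l x, T (totalDerivContact l x) = totalDeriv l (T x)) {φ : S1 n m q (r + 1)}
    (hφ : φ ∈ LinearMap.range (dH1 n m q r)) :
    T.compAlternatingMap φ ∈ LinearMap.range (dH0 n m q r) := by
  rw [range_dH1] at hφ
  obtain ⟨ψ, rfl⟩ := hφ
  exact ⟨_, (wedgeD_comp hT ψ).symm⟩

theorem dH0_dH0 {r : ℕ} (φ : S0 n m q r) : dH0 n m q (r + 1) (dH0 n m q r φ) = 0 :=
  wedgeD_wedgeD _ totalDeriv_comm φ

theorem dV0_mem_of_sub_mem {r : ℕ} {φ ψ : S0 n m q (r + 1)}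
    (h : φ - ψ ∈ LinearMap.range (dH0 n m q r))
    (hφ : dV0 n m q (r + 1) φ ∈ LinearMap.range (dH1 n m q r)) :
    dV0 n m q (r + 1) ψ ∈ LinearMap.range (dH1 n m q r) := by
  obtain ⟨χ, hχ⟩ := h
  have : ψ = φ - dH0 n m q r χ := by rw [hχ, sub_sub_cancel]
  rw [this, map_sub, vertFun_dH0]
  exact sub_mem hφ (neg_mem (LinearMap.mem_range_self _ _))

theorem dH0_eq_zero_of_sub_mem {r : ℕ} {φ ψ : S0 n m q (r + 1)}
    (h : φ - ψ ∈ LinearMap.range (dH0 n m q r)) (hφ : dH0 n m q (r + 1) φ = 0) :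
    dH0 n m q (r + 1) ψ = 0 := by
  obtain ⟨χ, hχ⟩ := h
  have : ψ = φ - dH0 n m q r χ := by rw [hχ, sub_sub_cancel]
  rw [this, map_sub, dH0_dH0, hφ, sub_zero]

theorem oddProduct_mem_range_dH0 {r K : ℕ} {φ : S0 n m q (r + 1)}
    (hφ : ∀ i L v, fibrePartial (Sum.inl i, L) (φ v) = 0) (hd : dH0 n m q (r + 1) φ = 0)
    (hK : ∀ v, ∃ f, body f = oddProduct K (φ v)) :
    (oddProduct K).compAlternatingMap φ ∈ LinearMap.range (dH0 n m q r) := by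
  refine mem_range_of_vertFun_eq_zero _ (fun v => vertFun_eq_zero_iff.2 ?_) ?_
  · rintro ⟨i | a, L⟩
    · rw [LinearMap.compAlternatingMap_apply, fibrePartial_oddProduct, hφ, map_zero]
    · obtain ⟨f, hf⟩ := hK v
      rw [LinearMap.compAlternatingMap_apply, ← hf, fibrePartial_inr_body]
  · have h : (oddProduct K).compAlternatingMap (dH0 n m q (r + 1) φ) = 0 := by
      rw [hd]
      ext v
      simp
    exact (wedgeD_comp (oddProduct_totalDeriv K) φ).symm.trans h

theorem oddNumber_mem_range_dH0 {r : ℕ} {φ : S0 n m q (r + 1)}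
    (hφ : φ ∈ LinearMap.range (dH0 n m q r)) :
    oddNumber.compAlternatingMap φ ∈ LinearMap.range (dH0 n m q r) := by
  obtain ⟨χ, rfl⟩ := hφ
  exact ⟨_, (wedgeD_comp oddNumber_totalDeriv χ).symm⟩

/-- Modulo boundaries the odd product multiplies `φ` by a nonzero scalar, and its value is a closed
form in `x` alone, to which the Poincaré lemma applies. -/
theorem mem_range_dH0_of_fibrePartial_inl {r : ℕ} (φ : S0 n m q (r + 1))
    (hφ : ∀ i L v, fibrePartial (Sum.inl i, L) (φ v) = 0) (hd : dH0 n m q (r + 1) φ = 0)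
    (hv : dV0 n m q (r + 1) φ ∈ LinearMap.range (dH1 n m q r)) :
    φ ∈ LinearMap.range (dH0 n m q r) := by
  obtain ⟨K, hK⟩ := HForm.exists_forall_mem _ oddProduct_mem_mono exists_oddProduct_mem φ
  have hN : oddNumber.compAlternatingMap φ ∈ LinearMap.range (dH0 n m q r) := by
    have h := comp_mem_range_dH0 oddContract oddContract_totalDerivContact hv
    have he : oddNumber.compAlternatingMap φ =
        oddContract.compAlternatingMap (dV0 n m q (r + 1) φ) := AlternatingMap.ext fun _ => rfl
    rwa [he]
  obtain ⟨c, hc, h2⟩ := exists_oddProduct_sub_mem _ (fun _ => oddNumber_mem_range_dH0) hN K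
  have h3 := oddProduct_mem_range_dH0 hφ hd hK
  exact (Submodule.smul_mem_iff _ hc).1 ((Submodule.sub_mem_iff_right _ h3).1 h2)

theorem mem_range_dH0 {r : ℕ} (φ : S0 n m q (r + 1)) (hd : dH0 n m q (r + 1) φ = 0)
    (hv : dV0 n m q (r + 1) φ ∈ LinearMap.range (dH1 n m q r)) :
    φ ∈ LinearMap.range (dH0 n m q r) := by
  set φ₁ := (grestrict (fibreSet n m)).compAlternatingMap φ with hφ₁
  have h1 : φ - φ₁ ∈ LinearMap.range (dH0 n m q r) := by
    have h := comp_mem_range_dH0 evenContract evenContract_totalDerivContact hv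
    convert h using 1
    ext v
    exact (evenContract_vertFun (φ v)).symm
  have hv1 := dV0_mem_of_sub_mem h1 hv
  have hd1 := dH0_eq_zero_of_sub_mem h1 hd
  have hφ₁' : ∀ i L v, fibrePartial (Sum.inl i, L) (φ₁ v) = 0 := fun i L v =>
    fibrePartial_grestrict i L (φ v)
  have h := add_mem h1 (mem_range_dH0_of_fibrePartial_inl φ₁ hφ₁' hd1 hv1)
  rwa [sub_add_cancel] at h

theorem vertFun_algebraMap (c : ℝ) : vertFun (algebraMap ℝ (GradedFun n m q) c) = 0 := by
  rw [Algebra.algebraMap_eq_smul_one, map_smul, vertFun_eq_zero_iff.2, smul_zero]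
  rintro ⟨i | a, L⟩
  · have h := evenPartial_mul (Sum.inr (i, L)) (1 : SmoothFun n m) 1
    simp only [mul_one, one_mul, left_eq_add] at h
    simp [Algebra.TensorProduct.one_def, fibrePartial, h]
  · exact fibrePartial_inr_body a L 1

theorem basePartial_algebraMap (l : Fin n) (c : ℝ) :
    basePartial l (algebraMap ℝ (GradedFun n m q) c) = 0 := by
  have h := evenPartial_mul (Sum.inl l) (1 : SmoothFun n m) 1
  simp only [mul_one, one_mul, left_eq_add] at h
  rw [Algebra.algebraMap_eq_smul_one, map_smul]
  simp [Algebra.TensorProduct.one_def, basePartial, h]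

theorem constants_apply (c : ℝ) (v : Fin 0 → Fin n → ℝ) :
    constants n m q c v = algebraMap ℝ (GradedFun n m q) c := rfl

/-- This criterion holds in every degree and transfers exactness from the one-contact complex, which
supplies the second condition. -/
theorem mem_boundary0_iff {r : ℕ} (φ : S0 n m q r) :
    φ ∈ boundary0 n m q r ↔ dH0 n m q r φ = 0 ∧ dV0 n m q r φ ∈ boundary1 n m q r := by
  cases r with
  | zero =>
    constructor
    · rintro ⟨c, rfl⟩
      refine ⟨?_, ?_⟩
      · rw [dH0]
        ext v
        simp only [wedgeD_apply, dirOp, constants_apply, LinearMap.sum_apply,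
          LinearMap.smul_apply, totalDeriv_of_vertFun_eq_zero _ (vertFun_algebraMap c),
          basePartial_algebraMap, smul_zero, Finset.sum_const_zero, AlternatingMap.zero_apply]
      · change dV0 n m q 0 _ = 0
        ext v
        exact vertFun_algebraMap c
    · rintro ⟨hd, hv⟩
      have hv0 : ∀ v, vertFun (φ v) = 0 := fun v =>
        congrArg (fun ψ : S1 n m q 0 => ψ v) (show dV0 n m q 0 φ = 0 from hv)
      obtain ⟨c, hc⟩ := exists_constant_of_vertFun_eq_zero (φ 0) (hv0 0) (fun l => by
        rw [← totalDeriv_of_vertFun_eq_zero l (hv0 0)]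
        have h := congrArg (fun ψ : S0 n m q 1 => ψ fun _ => Pi.single l 1) hd
        have h0 : ∀ w : Fin 0 → Fin n → ℝ, φ w = φ 0 := fun w =>
          congrArg φ (Subsingleton.elim w 0)
        simpa [dH0, wedgeD_apply, dirOp_single, h0] using h)
      refine ⟨c, ?_⟩
      ext v
      rw [constants_apply, ← hc, Subsingleton.elim v 0]
  | succ r =>
    constructor
    · rintro ⟨χ, rfl⟩
      refine ⟨dH0_dH0 χ, ?_⟩
      rw [vertFun_dH0]
      exact neg_mem (LinearMap.mem_range_self _ _)
    · exact fun h => mem_range_dH0 φ h.1 h.2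

theorem dH1_dV0_eq_zero {r : ℕ} {φ : S0 n m q r} (hd : dH0 n m q r φ = 0) :
    dH1 n m q r (dV0 n m q r φ) = 0 := by
  rw [← neg_eq_zero, ← vertFun_dH0, hd, map_zero]

theorem ker_dH0 {r : ℕ} (hr : r < n) : LinearMap.ker (dH0 n m q r) = boundary0 n m q r := by
  ext φ
  rw [mem_boundary0_iff, LinearMap.mem_ker, ← ker_dH1 hr, LinearMap.mem_ker]
  exact ⟨fun h => ⟨h, dH1_dV0_eq_zero h⟩, fun h => h.1⟩

theorem ker_delta : LinearMap.ker (delta n m q) = boundary0 n m q n := by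
  ext φ
  rw [mem_boundary0_iff, LinearMap.mem_ker, ← ker_rhoE1, LinearMap.mem_ker]
  -- In top degree `d_H φ = 0` is automatic, since there are no horizontal `(n+1)`-forms.
  exact ⟨fun h => ⟨Subsingleton.elim _ _, h⟩, fun h => h.2⟩

end GradedJet

end

theorem mainTheorem10 (n m q : ℕ) :
    -- exactness of `0 → ℝ → S^{0,0} → ⋯ → S^{0,n} → E₁` at `S^{0,r}`, `0 ≤ r ≤ n`
    ((∀ r : ℕ, r < n →
        LinearMap.ker (GradedJet.dH0 n m q r) = GradedJet.boundary0 n m q r) ∧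
      LinearMap.ker (GradedJet.delta n m q) = GradedJet.boundary0 n m q n) ∧
    -- exactness of `0 → S^{1,0} → ⋯ → S^{1,n} → E₁ → 0` at `S^{1,r}`, `0 ≤ r ≤ n`, and at `E₁`
    ((∀ r : ℕ, r < n →
        LinearMap.ker (GradedJet.dH1 n m q r) = GradedJet.boundary1 n m q r) ∧
      LinearMap.ker (GradedJet.rhoE1 n m q) = GradedJet.boundary1 n m q n ∧
      LinearMap.range (GradedJet.rhoE1 n m q) = ⊤) :=
  ⟨⟨fun _ hr => GradedJet.ker_dH0 hr, GradedJet.ker_delta⟩,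
    fun _ hr => GradedJet.ker_dH1 hr, GradedJet.ker_rhoE1, LinearMap.range_rangeRestrict _⟩
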